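/- Let $M$ be a compact smooth surface with smooth boundary $\partial M$, and let $u\colon M\to\mathbb{R}^n$ be a branched immersion that is injective on $\partial M$. That is, $u$ is $C^1$ up to the boundary, and for every $p\in M$ either $u$ is an immersion near $p$, or there are an integer $m\ge 2$, a local $C^1$ coordinate $z$ on $M$ with values in $\mathbb{C}$ and $z(p)=0$, and a map $f$ such that, after a rigid motion of $\mathbb{R}^n\simeq\mathbb{C}\times\mathbb{R}^{n-2}$, $u=(z^m,f(z))$ near $p$. Put $\Gamma=u(\partial M)$. Let $dA=Ju\,d\mathcal{H}^2$ with $Ju=\sqrt{\det(du^*\circ du)}$ be the area measure of $u$ on $M$, and write $\int_{M\cap B}\cdot\,dA$ for the integral over $u^{-1}(B)$ and $\operatorname{area}(M\cap B)=\int_{M\cap B}dA$, so that area is counted with multiplicity. For $T\subset[0,\infty)$, the area of a cone piece $\{x_0+t(x-x_0):x\in\Gamma,\ t\in T\}$ is likewise counted with multiplicity, i.e. it is the integral of the Jacobian of $(x,t)\mapsto x_0+t(x-x_0)$ on $\Gamma\times T$. Balls $B_r(x)$ are open. Suppose that $M$ has mean curvature vector $H$: $H\colon M\to\mathbb{R}^n$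 is an integrable normal vector field with $\int_M\operatorname{div}_MX\,dA=\int_MX\cdot H\,dA$ for all $C^1$ vector fields $X$ with compact support in $\mathbb{R}^n\setminus\Gamma$. Suppose moreover that the divergence identity with boundary term holds: $$\int_M\operatorname{div}_MX\,dA=\int_MX\cdot H\,dA+\int_\Gamma X\cdot\nu_M\,d\mathcal{H}^1\qquad\text{for every }C^1\text{ vector field }X\text{ on }\mathbb{R}^n,$$ where $\nu_M$ is the outward unit normal to $\Gamma$ tangent to $M$. Let $x_0\in\mathbb{R}^n$, let $E=\{x_0+t(x-x_0):x\in\Gamma,\ t\ge1\}$ be the exterior cone, and put $$m(r)=\frac{\operatorname{area}(M\cap B_r(x_0))+\operatorname{area}(E\cap B_r(x_0))}{r^2}.$$ Suppose that property (P) holds with constants $\alpha\in(0,1]$ and $\Lambda\ge0$: $$\int_{M\cap B_r(x_0)}|H|\,dA\le\alpha\Lambda r^{\alpha+1}m(r)\qquad\text{for all }r>0.$$ Let $r_0=\max_{x,y\in u(M)}|x-y|$ be the extrinsic diameter of $M$ (with $r_0=0$ if $M=\emptyset$), and let $C_{x_0}\Gamma=\{x_0+t(x-x_0):x\in\Gamma,\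 0\le t\le1\}$. Densities are $\Theta(S,x_0)=\lim_{r\to0}\operatorname{area}(S\cap B_r(x_0))/(\pi r^2)$. Then $\Theta(C_{x_0}\Gamma,x_0)$ exists in $[0,\infty]$, and $$\Theta(C_{x_0}\Gamma,x_0)\ \ge\ e^{-\Lambda r_0^\alpha}\Bigl(1-\frac{\alpha\Lambda r_0^\alpha}{2}\Bigr)\,\Theta(M,x_0).$$ Here, if $\Theta(C_{x_0}\Gamma,x_0)<\infty$, the limit $\Theta(M,x_0)$ exists and is finite; in any case the inequality holds with the upper density ($\limsup$ in place of $\lim$) of $M$ at $x_0$, its right side being read as $0$ when $1-\alpha\Lambda r_0^\alpha/2\le0$. -/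

import Mathlib

open Set Filter Topology MeasureTheory
open scoped ENNReal Manifold ContDiff

noncomputable section

namespace BranchedSurface

/-- `ℝᵏ` with its Euclidean norm. -/
abbrev E (k : ℕ) : Type := EuclideanSpace ℝ (Fin k)

variable {n : ℕ}
variable {M : Type*} [TopologicalSpace M] [ChartedSpace (EuclideanHalfSpace 2) M]

/-- The differential `du_p : T_pM → ℝⁿ`, where `T_pM` is identified with `ℝ²` by the preferred chart
at `p`. When `p` is a boundary point, `v ∈ T_pM` is tangent to `∂M` iff `v 0 = 0`, and it points
into `M` iff `0 < v 0`. -/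
def du (u : M → E n) (p : M) : E 2 →L[ℝ] E n := mfderiv (𝓡∂ 2) 𝓘(ℝ, E n) u p

/-- Case (i): `u` is an immersion in a neighbourhood of `p`. -/
def IsImmersedNear (u : M → E n) (p : M) : Prop :=
  ∀ᶠ q in 𝓝 p, Function.Injective (du u q)

/-- Case (ii): `u` has a branch point at `p`. There are `m ≥ 2`, a local `C¹` coordinate
`z : M → ℂ` centred at `p` and a rigid motion of `ℝⁿ`, identified with `ℂ × ℝⁿ⁻²`, such that
`u = (z ^ m, f(z))` near `p`. -/
def IsBranchPoint (u : M → E n) (p : M) : Prop :=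
  ∃ (m : ℕ) (z : M → ℂ) (R : WithLp 2 (ℂ × E (n - 2)) ≃ₗᵢ[ℝ] E n) (a : E n) (f : ℂ → E (n - 2)),
    2 ≤ m ∧ z p = 0 ∧ ContMDiffAt (𝓡∂ 2) 𝓘(ℝ, ℂ) 1 z p ∧
    Function.Bijective (mfderiv (𝓡∂ 2) 𝓘(ℝ, ℂ) z p) ∧
    ∀ᶠ q in 𝓝 p, u q = a + R (WithLp.toLp 2 (z q ^ m, f (z q)))

/-- A branched immersion: a `C¹` map (up to the boundary) that near every point is an immersion or
has a branch point there. -/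
def IsBranchedImmersion (u : M → E n) : Prop :=
  ContMDiff (𝓡∂ 2) 𝓘(ℝ, E n) 1 u ∧ ∀ p : M, IsImmersedNear u p ∨ IsBranchPoint u p

/-- The Jacobian `√(det (L* ∘ L))` of a linear map `L : ℝ² → ℝⁿ`. -/
def jacobian (L : E 2 →L[ℝ] E n) : ℝ :=
  √(LinearMap.det ((ContinuousLinearMap.adjoint L ∘L L : E 2 →L[ℝ] E 2) : E 2 →ₗ[ℝ] E 2))

/-- The part of the area measure of `u` in the domain of the preferred chart `φ` at `p`: the
image under `φ⁻¹` of Lebesgue measure on the range of `φ` times the Jacobian of `u ∘ φ⁻¹`. -/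
def chartArea [MeasurableSpace M] (u : M → E n) (p : M) : Measure M :=
  ((volume.restrict (extChartAt (𝓡∂ 2) p).target).withDensity fun y =>
    ENNReal.ofReal (jacobian
      (fderivWithin ℝ (u ∘ (extChartAt (𝓡∂ 2) p).symm) (range (𝓡∂ 2)) y))).map
    (extChartAt (𝓡∂ 2) p).symm

/-- The area measure `dA = Ju dℋ²` of `u` on `M`. The measures `chartArea u p` agree on the overlaps
of the charts, so their supremum is the measure that coincides with each of them on the
domain of its chart. -/
def areaMeasure [MeasurableSpace M] (u : M → E n) : Measure M := ⨆ p : M, chartArea u p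

/-- The area, with multiplicity, of `M ∩ B_r(x)`, i.e. the integral of `Ju` over `u⁻¹(B_r(x))`. -/
def surfaceArea [MeasurableSpace M] (u : M → E n) (x : E n) (r : ℝ) : ℝ≥0∞ :=
  areaMeasure u (u ⁻¹' Metric.ball x r)

/-- The extrinsic diameter `r₀` of the image of `M`. -/
def extrinsicDiam (u : M → E n) : ℝ := Metric.diam (range u)

/-- The boundary `∂M` of the surface; `Γ` is its image under `u`. -/
abbrev bdry (M : Type*) [TopologicalSpace M] [ChartedSpace (EuclideanHalfSpace 2) M] : Set M :=
  (𝓡∂ 2).boundary M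

/-- One-dimensional Hausdorff measure on `Γ = u(∂M)`, transported to `∂M` by the injective map
`u|_{∂M}`. -/
def bdryMeasure [MeasurableSpace M] (u : M → E n) : Measure (bdry M) :=
  Measure.comap (fun p : bdry M => u p) (μH[1])

/-- The unit tangent vector of `Γ` at `u p`, for `p ∈ ∂M` (up to the sign; it is
not meaningful at branch points). -/
def unitTangent (u : M → E n) (p : M) : E n :=
  ‖du u p (EuclideanSpace.single 1 1)‖⁻¹ • du u p (EuclideanSpace.single 1 1)

/-- The component normal to `Γ` of the image under `du_p` of an outward pointing vector. -/
def outwardVector (u : M → E n) (p : M) : E n :=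
  -(du u p (EuclideanSpace.single 0 1) -
    inner ℝ (du u p (EuclideanSpace.single 0 1)) (unitTangent u p) • unitTangent u p)

/-- `ν_M`, the outward pointing unit vector that is tangent to `M` and normal to `Γ`, at `u p`
for `p ∈ ∂M` (not meaningful at branch points). -/
def conormal (u : M → E n) (p : M) : E n := ‖outwardVector u p‖⁻¹ • outwardVector u p

/-- `div_M X` at `p`: the trace of `DX` over the tangent plane `du_p(T_pM)`. -/
def tangentialDiv (u : M → E n) (X : E n → E n) (p : M) : ℝ :=
  LinearMap.trace ℝ (E n)
    ((((LinearMap.range (du u p : E 2 →ₗ[ℝ] E n)).starProjection ∘L fderiv ℝ X (u p) :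
      E n →L[ℝ] E n)) : E n →ₗ[ℝ] E n)

/-- `H` is a (locally) integrable normal vector field that is the mean curvature vector of `M`, with
the sign convention `∫_M div_M X = ∫_M X · H` for `C¹` fields `X` with compact support in
`ℝⁿ ∖ Γ`. -/
def HasMeanCurvature [MeasurableSpace M] (u : M → E n) (H : M → E n) : Prop :=
  Integrable H (areaMeasure u) ∧
  (∀ᵐ p ∂(areaMeasure u), ∀ v : E 2, inner ℝ (H p) (du u p v) = 0) ∧
  ∀ X : E n → E n, ContDiff ℝ 1 X → HasCompactSupport X → Disjoint (tsupport X) (u '' bdry M) →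
    ∫ p, tangentialDiv u X p ∂(areaMeasure u) = ∫ p, inner ℝ (X (u p)) (H p) ∂(areaMeasure u)

/-- The divergence identity with boundary term,
`∫_M div_M X dA = ∫_M X · H dA + ∫_Γ X · ν_M dℋ¹` for every `C¹` vector field `X` on `ℝⁿ`. -/
def DivergenceIdentity [MeasurableSpace M] (u : M → E n) (H : M → E n) : Prop :=
  ∀ X : E n → E n, ContDiff ℝ 1 X →
    ∫ p, tangentialDiv u X p ∂(areaMeasure u) =
      ∫ p, inner ℝ (X (u p)) (H p) ∂(areaMeasure u) +
        ∫ p : bdry M, inner ℝ (X (u p)) (conormal u p) ∂(bdryMeasure u)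

/-- The area of the parallelogram spanned by `v` and `w`. -/
def parallelogramArea (v w : E n) : ℝ := √(‖v‖ ^ 2 * ‖w‖ ^ 2 - inner ℝ v w ^ 2)

/-- The area, with multiplicity, inside `B_r(x₀)` of the piece
`{x₀ + t (x - x₀) : x ∈ Γ, t ∈ T}` of the cone over `Γ` with vertex `x₀`: the integral over
`Γ × T` of the Jacobian of `(x, t) ↦ x₀ + t (x - x₀)`, whose partial derivatives are `x - x₀`
in `t` and `t τ` in the direction of the unit tangent `τ` of `Γ`. -/
def coneArea [MeasurableSpace M] (u : M → E n) (x₀ : E n) (T : Set ℝ) (r : ℝ) : ℝ≥0∞ :=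
  ∫⁻ p : bdry M, (∫⁻ t : ℝ in {t : ℝ | t ∈ T ∧ x₀ + t • (u p - x₀) ∈ Metric.ball x₀ r},
    ENNReal.ofReal (parallelogramArea (u p - x₀) (t • unitTangent u p))) ∂(bdryMeasure u)

/-- `m(r) = area(M' ∩ B_r(x₀)) / r²`, where `M'` is the union of `M` and the exterior cone
`{x₀ + t (x - x₀) : x ∈ Γ, t ≥ 1}`. -/
def extendedRatio [MeasurableSpace M] (u : M → E n) (x₀ : E n) (r : ℝ) : ℝ≥0∞ :=
  (surfaceArea u x₀ r + coneArea u x₀ (Ici 1) r) / ENNReal.ofReal (r ^ 2)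

/-- Property (P) with constants `α`, `Λ` for the balls centred at `x₀`. -/
def PropertyP [MeasurableSpace M] (u : M → E n) (H : M → E n) (x₀ : E n) (α Λ : ℝ) : Prop :=
  0 < α ∧ α ≤ 1 ∧ 0 ≤ Λ ∧ ∀ r : ℝ, 0 < r →
    ∫⁻ p in u ⁻¹' Metric.ball x₀ r, ‖H p‖ₑ ∂(areaMeasure u) ≤
      ENNReal.ofReal (α * Λ * r ^ (α + 1)) * extendedRatio u x₀ r

/-- If `A r` is the area of a surface in `B_r(x)`, the surface has density `θ` at `x`. -/
def HasDensity (A : ℝ → ℝ≥0∞) (θ : ℝ≥0∞) : Prop :=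
  Tendsto (fun r => A r / ENNReal.ofReal (Real.pi * r ^ 2)) (𝓝[>] 0) (𝓝 θ)

/-- The upper density, which is the density whenever the latter exists. -/
def upperDensity (A : ℝ → ℝ≥0∞) : ℝ≥0∞ :=
  limsup (fun r => A r / ENNReal.ofReal (Real.pi * r ^ 2)) (𝓝[>] 0)

end BranchedSurface

end

/-!
Testing the divergence identity with the radial fields `φ(‖x - x₀‖²) (x - x₀)`, where `φ(s)` is a
`C¹` approximation of `max(1 / max(σ², s) - 1 / r², 0)`, bounds the drop of `area(M ∩ B) / r²` from
the radius `σ` to the radius `r` by a curvature term and a boundary term. Since `ν_M` is a unit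
vector orthogonal to the unit tangent `τ` of `Γ`, `|(x - x₀) · ν_M|` is at most the area of the
parallelogram spanned by `x - x₀` and `τ`, which is also the density of the cone over `Γ`; hence the
exterior cone absorbs the boundary term and `m(σ) - m(r)` is bounded by the curvature term alone.
With property (P), Grönwall's inequality makes `exp(Λ r^α) m(r)` nondecreasing, so that
`π Θ(M, x₀) ≤ exp(Λ σ^α) m(σ)` for every `σ`. If `M` lies in `B_σ(x₀)`, the curvature term is
controlled by `σ` alone; letting `r → ∞` then gives `m(σ) (1 - α Λ σ^α / 2) ≤ π Θ(C, x₀)`, and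
finally `σ` decreases to the extrinsic diameter.
-/

noncomputable section

namespace BranchedSurface

section Charts

variable {n : ℕ} {M : Type*} [TopologicalSpace M] [ChartedSpace (EuclideanHalfSpace 2) M]

lemma measurableSet_extChartAt_target (p : M) : MeasurableSet (extChartAt (𝓡∂ 2) p).target := by
  rw [extChartAt_target]
  exact ((chartAt (EuclideanHalfSpace 2) p).open_target.preimage
    (𝓡∂ 2).continuous_symm).measurableSet.inter (𝓡∂ 2).isClosed_range.measurableSet

lemma exists_finset_iUnion_extChartAt_source_eq_univ [CompactSpace M] :
    ∃ t : Finset M, ⋃ p ∈ t, (extChartAt (𝓡∂ 2) p).source = univ :=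
  CompactSpace.elim_nhds_subcover _ fun p => extChartAt_source_mem_nhds (I := 𝓡∂ 2) p

/-- The differential of `u` read in the preferred chart at `p`, as a function on the range of that
chart. -/
def chartDeriv (u : M → E n) (p : M) (y : E 2) : E 2 →L[ℝ] E n :=
  fderivWithin ℝ (u ∘ (extChartAt (𝓡∂ 2) p).symm) (range (𝓡∂ 2)) y

lemma chartDeriv_extChartAt_self {u : M → E n} (hu : ContMDiff (𝓡∂ 2) 𝓘(ℝ, E n) 1 u) (p : M) :
    chartDeriv u p (extChartAt (𝓡∂ 2) p p) = du u p :=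
  (if_pos ((hu p).mdifferentiableAt one_ne_zero)).symm

variable [IsManifold (𝓡∂ 2) 1 M] {u : M → E n} {p q x : M}

lemma contDiffWithinAt_comp_extChartAt_symm (hu : ContMDiff (𝓡∂ 2) 𝓘(ℝ, E n) 1 u) {y : E 2}
    (hy : y ∈ (extChartAt (𝓡∂ 2) p).target) :
    ContDiffWithinAt ℝ 1 (u ∘ (extChartAt (𝓡∂ 2) p).symm) (range (𝓡∂ 2)) y :=
  contMDiffWithinAt_iff_contDiffWithinAt.1 <| (hu _).comp_contMDiffWithinAt y <|
    (contMDiffOn_extChartAt_symm p y hy).mono_of_mem_nhdsWithin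
      (extChartAt_target_mem_nhdsWithin_of_mem hy)

lemma hasFDerivWithinAt_chartDeriv (hu : ContMDiff (𝓡∂ 2) 𝓘(ℝ, E n) 1 u) {y : E 2}
    (hy : y ∈ (extChartAt (𝓡∂ 2) p).target) :
    HasFDerivWithinAt (u ∘ (extChartAt (𝓡∂ 2) p).symm) (chartDeriv u p y) (range (𝓡∂ 2)) y :=
  ((contDiffWithinAt_comp_extChartAt_symm hu hy).differentiableWithinAt
    one_ne_zero).hasFDerivWithinAt

lemma continuousOn_chartDeriv (hu : ContMDiff (𝓡∂ 2) 𝓘(ℝ, E n) 1 u) (p : M) :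
    ContinuousOn (chartDeriv u p) (extChartAt (𝓡∂ 2) p).target := by
  have h : ContDiffOn ℝ 1 (u ∘ (extChartAt (𝓡∂ 2) p).symm) (extChartAt (𝓡∂ 2) p).target :=
    fun y hy => (contDiffWithinAt_comp_extChartAt_symm hu hy).mono
      (extChartAt_target_subset_range p)
  refine (h.continuousOn_fderivWithin (uniqueDiffOn_extChartAt_target p) le_rfl).congr ?_
  exact fun y hy => fderivWithin_congr_set (extChartAt_target_eventuallyEq_of_mem hy).symm

lemma continuousOn_chartDeriv_extChartAt (hu : ContMDiff (𝓡∂ 2) 𝓘(ℝ, E n) 1 u) (p : M) :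
    ContinuousOn (fun q => chartDeriv u p (extChartAt (𝓡∂ 2) p q)) (extChartAt (𝓡∂ 2) p).source :=
  (continuousOn_chartDeriv hu p).comp (continuousOn_extChartAt p)
    fun _ hq => (extChartAt (𝓡∂ 2) p).map_source hq

lemma chartDeriv_comp_tangentCoordChange (hu : ContMDiff (𝓡∂ 2) 𝓘(ℝ, E n) 1 u)
    (hp : x ∈ (extChartAt (𝓡∂ 2) p).source) (hq : x ∈ (extChartAt (𝓡∂ 2) q).source) :
    chartDeriv u q (extChartAt (𝓡∂ 2) q x) ∘L tangentCoordChange (𝓡∂ 2) p q x =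
      chartDeriv u p (extChartAt (𝓡∂ 2) p x) := by
  have hpx := (extChartAt (𝓡∂ 2) p).map_source hp
  have hx : (extChartAt (𝓡∂ 2) p).symm (extChartAt (𝓡∂ 2) p x) = x :=
    (extChartAt (𝓡∂ 2) p).left_inv hp
  have hsource : (extChartAt (𝓡∂ 2) p).symm ⁻¹' (extChartAt (𝓡∂ 2) q).source ∈
      𝓝[range (𝓡∂ 2)] (extChartAt (𝓡∂ 2) p x) :=
    (continuousAt_extChartAt_symm' hp).continuousWithinAt (by
      rw [hx]; exact extChartAt_source_mem_nhds' hq)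
  have hcongr : (u ∘ (extChartAt (𝓡∂ 2) q).symm) ∘
      (extChartAt (𝓡∂ 2) q ∘ (extChartAt (𝓡∂ 2) p).symm) =ᶠ[𝓝[range (𝓡∂ 2)] extChartAt (𝓡∂ 2) p x]
        u ∘ (extChartAt (𝓡∂ 2) p).symm := by
    filter_upwards [hsource] with y hy
    simp only [Function.comp_apply, (extChartAt (𝓡∂ 2) q).left_inv hy]
  have houter : HasFDerivWithinAt (u ∘ (extChartAt (𝓡∂ 2) q).symm)
      (chartDeriv u q (extChartAt (𝓡∂ 2) q x)) (range (𝓡∂ 2))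
      ((extChartAt (𝓡∂ 2) q ∘ (extChartAt (𝓡∂ 2) p).symm) (extChartAt (𝓡∂ 2) p x)) := by
    rw [Function.comp_apply, hx]
    exact hasFDerivWithinAt_chartDeriv hu ((extChartAt (𝓡∂ 2) q).map_source hq)
  have hcomp := houter.comp _ (hasFDerivWithinAt_tangentCoordChange ⟨hp, hq⟩)
    fun y _ => mem_range_self _
  have hmem := extChartAt_target_subset_range p hpx
  exact ((𝓡∂ 2).uniqueDiffOn _ hmem).eq
    (hcomp.congr_of_eventuallyEq hcongr.symm (hcongr.symm.self_of_nhdsWithin hmem))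
    (hasFDerivWithinAt_chartDeriv hu hpx)

lemma injective_tangentCoordChange (hp : x ∈ (extChartAt (𝓡∂ 2) p).source)
    (hq : x ∈ (extChartAt (𝓡∂ 2) q).source) :
    Function.Injective (tangentCoordChange (𝓡∂ 2) p q x) :=
  Function.LeftInverse.injective (g := tangentCoordChange (𝓡∂ 2) q p x) fun _ =>
    (tangentCoordChange_comp ⟨⟨hp, hq⟩, hp⟩).trans (tangentCoordChange_self hp)

lemma range_chartDeriv (hu : ContMDiff (𝓡∂ 2) 𝓘(ℝ, E n) 1 u)
    (hq : q ∈ (extChartAt (𝓡∂ 2) p).source) :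
    LinearMap.range (chartDeriv u p (extChartAt (𝓡∂ 2) p q) : E 2 →ₗ[ℝ] E n) =
      LinearMap.range (du u q : E 2 →ₗ[ℝ] E n) := by
  rw [← chartDeriv_extChartAt_self hu q]
  apply le_antisymm
  · rw [← chartDeriv_comp_tangentCoordChange hu hq (mem_extChartAt_source q)]
    exact LinearMap.range_comp_le_range _ _
  · rw [← chartDeriv_comp_tangentCoordChange hu (mem_extChartAt_source q) hq]
    exact LinearMap.range_comp_le_range _ _

lemma injective_chartDeriv_iff (hu : ContMDiff (𝓡∂ 2) 𝓘(ℝ, E n) 1 u)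
    (hq : q ∈ (extChartAt (𝓡∂ 2) p).source) :
    Function.Injective (chartDeriv u p (extChartAt (𝓡∂ 2) p q)) ↔
      Function.Injective (du u q) := by
  rw [← chartDeriv_extChartAt_self hu q]
  constructor <;> intro h
  · rw [← chartDeriv_comp_tangentCoordChange hu (mem_extChartAt_source q) hq]
    exact h.comp (injective_tangentCoordChange (mem_extChartAt_source q) hq)
  · rw [← chartDeriv_comp_tangentCoordChange hu hq (mem_extChartAt_source q)]
    exact h.comp (injective_tangentCoordChange hq (mem_extChartAt_source q))

lemma isOpen_injective_du (hu : ContMDiff (𝓡∂ 2) 𝓘(ℝ, E n) 1 u) :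
    IsOpen {q : M | Function.Injective (du u q)} := by
  refine isOpen_iff_mem_nhds.2 fun p hp => ?_
  have hcont : ContinuousAt (fun q => chartDeriv u p (extChartAt (𝓡∂ 2) p q)) p :=
    (continuousOn_chartDeriv_extChartAt hu p).continuousAt (extChartAt_source_mem_nhds p)
  have hinj := hcont.eventually (ContinuousLinearMap.isOpen_injective.mem_nhds
    ((injective_chartDeriv_iff hu (mem_extChartAt_source p)).2 hp))
  filter_upwards [hinj, extChartAt_source_mem_nhds (I := 𝓡∂ 2) p] with q hq hqp
  exact (injective_chartDeriv_iff hu hqp).1 hq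

end Charts

section Area

lemma jacobian_eq_normDet {n : ℕ} (L : E 2 →L[ℝ] E n) :
    jacobian L = (L : E 2 →ₗ[ℝ] E n).normDet := by
  refine (congrArg Real.sqrt (ContinuousLinearMap.normDet_sq L).symm).trans ?_
  exact Real.sqrt_sq (LinearMap.normDet_nonneg _)

lemma jacobian_comp {n : ℕ} (L : E 2 →L[ℝ] E n) (B : E 2 →L[ℝ] E 2) :
    jacobian (L ∘L B) = |B.det| * jacobian L := by
  rw [jacobian_eq_normDet, jacobian_eq_normDet, ContinuousLinearMap.toLinearMap_comp,
    LinearMap.normDet_comp_of_finrank_eq _ _ rfl, LinearMap.normDet_eq_abs_det, mul_comm]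

lemma jacobian_eq_zero_of_not_injective {n : ℕ} {L : E 2 →L[ℝ] E n}
    (hL : ¬ Function.Injective L) : jacobian L = 0 := by
  rw [jacobian_eq_normDet, LinearMap.normDet_eq_zero_iff_ker_ne_bot]
  exact fun h => hL (LinearMap.ker_eq_bot.1 h)

lemma continuous_jacobian {n : ℕ} : Continuous (jacobian : (E 2 →L[ℝ] E n) → ℝ) :=
  Real.continuous_sqrt.comp <| ContinuousLinearMap.continuous_det.comp <|
    ContinuousLinearMap.adjoint.continuous.clm_comp continuous_id

variable {n : ℕ} {M : Type*} [TopologicalSpace M] [ChartedSpace (EuclideanHalfSpace 2) M]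
  [MeasurableSpace M] [BorelSpace M]

lemma chartArea_apply (u : M → E n) (p : M) {A : Set M} (hA : MeasurableSet A) :
    chartArea u p A = ∫⁻ y in (extChartAt (𝓡∂ 2) p).symm ⁻¹' A ∩ (extChartAt (𝓡∂ 2) p).target,
      ENNReal.ofReal (jacobian (chartDeriv u p y)) := by
  have h : AEMeasurable (extChartAt (𝓡∂ 2) p).symm
      (volume.restrict (extChartAt (𝓡∂ 2) p).target) :=
    (continuousOn_extChartAt_symm p).aemeasurable (measurableSet_extChartAt_target p)
  rw [chartArea, Measure.map_apply_of_aemeasurable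
    (h.mono_ac (withDensity_absolutelyContinuous _ _)) hA, withDensity_apply',
    Measure.restrict_restrict' (measurableSet_extChartAt_target p)]
  rfl

lemma measurableSet_extChartAt_symm_preimage (p : M) {A : Set M} (hA : MeasurableSet A) :
    MeasurableSet ((extChartAt (𝓡∂ 2) p).symm ⁻¹' A ∩ (extChartAt (𝓡∂ 2) p).target) := by
  have h := (measurableSet_extChartAt_target p).subtype_image
    ((continuousOn_extChartAt_symm (I := 𝓡∂ 2) p).domRestrict.measurable hA)
  rwa [domRestrict_eq, preimage_comp, Subtype.image_preimage_coe, inter_comm] at h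

variable [IsManifold (𝓡∂ 2) 1 M] {u : M → E n}

lemma chartArea_le_chartArea (hu : ContMDiff (𝓡∂ 2) 𝓘(ℝ, E n) 1 u) (p q : M) {A : Set M}
    (hA : MeasurableSet A) (hAp : A ⊆ (extChartAt (𝓡∂ 2) p).source) :
    chartArea u q A ≤ chartArea u p A := by
  rw [chartArea_apply u q hA, chartArea_apply u p hA]
  set T := (extChartAt (𝓡∂ 2) q).symm ⁻¹' A ∩ (extChartAt (𝓡∂ 2) q).target
  set φ := extChartAt (𝓡∂ 2) p ∘ (extChartAt (𝓡∂ 2) q).symm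
  set B : E 2 → E 2 →L[ℝ] E 2 := fun y =>
    tangentCoordChange (𝓡∂ 2) q p ((extChartAt (𝓡∂ 2) q).symm y)
  have hT : MeasurableSet T := measurableSet_extChartAt_symm_preimage q hA
  have hq : ∀ y ∈ T, (extChartAt (𝓡∂ 2) q).symm y ∈ (extChartAt (𝓡∂ 2) q).source :=
    fun y hy => (extChartAt (𝓡∂ 2) q).map_target hy.2
  have hφ : ∀ y ∈ T, HasFDerivWithinAt φ (B y) T y := fun y hy => by
    have h := hasFDerivWithinAt_tangentCoordChange (I := 𝓡∂ 2) ⟨hq y hy, hAp hy.1⟩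
    rw [(extChartAt (𝓡∂ 2) q).right_inv hy.2] at h
    exact h.mono (inter_subset_right.trans (extChartAt_target_subset_range q))
  have hinj : InjOn φ T := fun x hx y hy hxy =>
    (extChartAt (𝓡∂ 2) q).symm.injOn hx.2 hy.2
      ((extChartAt (𝓡∂ 2) p).injOn (hAp hx.1) (hAp hy.1) hxy)
  calc _ = ∫⁻ y in T, ENNReal.ofReal |(B y).det| *
          ENNReal.ofReal (jacobian (chartDeriv u p (φ y))) := by
        refine setLIntegral_congr_fun hT fun y hy => ?_
        have hchain := chartDeriv_comp_tangentCoordChange hu (hq y hy) (hAp hy.1)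
        rw [(extChartAt (𝓡∂ 2) q).right_inv hy.2] at hchain
        rw [← hchain, jacobian_comp, ENNReal.ofReal_mul (abs_nonneg _)]
        rfl
    _ = ∫⁻ y in φ '' T, ENNReal.ofReal (jacobian (chartDeriv u p y)) :=
        (lintegral_image_eq_lintegral_abs_det_fderiv_mul volume hT hφ hinj
          fun y => ENNReal.ofReal (jacobian (chartDeriv u p y))).symm
    _ ≤ _ := by
        refine lintegral_mono_set ?_
        rintro _ ⟨y, hy, rfl⟩
        refine ⟨?_, (extChartAt (𝓡∂ 2) p).map_source (hAp hy.1)⟩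
        exact (congrArg (· ∈ A) ((extChartAt (𝓡∂ 2) p).left_inv (hAp hy.1))).mpr hy.1

lemma areaMeasure_apply_of_subset_source (hu : ContMDiff (𝓡∂ 2) 𝓘(ℝ, E n) 1 u) {p : M}
    {A : Set M} (hA : MeasurableSet A) (hAp : A ⊆ (extChartAt (𝓡∂ 2) p).source) :
    areaMeasure u A = chartArea u p A := by
  refine le_antisymm ?_ (le_iSup (chartArea u) p A)
  have hle : areaMeasure u ≤ (chartArea u p).restrict A + (⊤ : Measure M).restrict Aᶜ := by
    refine iSup_le fun q => Measure.le_intro fun B hB _ => ?_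
    rw [Measure.add_apply, Measure.restrict_apply hB, Measure.restrict_apply hB]
    refine (measure_mono (inter_union_compl B A).ge).trans ((measure_union_le _ _).trans ?_)
    exact add_le_add (chartArea_le_chartArea hu p q (hB.inter hA) (inter_subset_right.trans hAp))
      (le_top (a := chartArea u q) _)
  simpa [Measure.restrict_apply hA] using hle A

lemma isLocallyFiniteMeasure_areaMeasure (hu : ContMDiff (𝓡∂ 2) 𝓘(ℝ, E n) 1 u) :
    IsLocallyFiniteMeasure (areaMeasure u) := by
  refine ⟨fun p => ?_⟩
  set f : M → E 2 × ℝ := fun q =>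
    (extChartAt (𝓡∂ 2) p q, jacobian (chartDeriv u p (extChartAt (𝓡∂ 2) p q)))
  set C := jacobian (chartDeriv u p (extChartAt (𝓡∂ 2) p p)) + 1
  have hf : ContinuousOn f (extChartAt (𝓡∂ 2) p).source := (continuousOn_extChartAt p).prodMk
    (continuous_jacobian.comp_continuousOn (continuousOn_chartDeriv_extChartAt hu p))
  set U := (extChartAt (𝓡∂ 2) p).source ∩ f ⁻¹' (Metric.ball (extChartAt (𝓡∂ 2) p p) 1 ×ˢ Iio C)
  have hU : IsOpen U := hf.isOpen_inter_preimage (isOpen_extChartAt_source p)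
    (Metric.isOpen_ball.prod isOpen_Iio)
  refine ⟨U, hU.mem_nhds ⟨mem_extChartAt_source p, by simp [f, C]⟩, ?_⟩
  set T := (extChartAt (𝓡∂ 2) p).symm ⁻¹' U ∩ (extChartAt (𝓡∂ 2) p).target
  have hT : ∀ y ∈ T, y ∈ Metric.ball (extChartAt (𝓡∂ 2) p p) 1 ∧
      jacobian (chartDeriv u p y) < C := by
    rintro y ⟨⟨-, hy⟩, hyt⟩
    have hy' : f ((extChartAt (𝓡∂ 2) p).symm y) = (y, jacobian (chartDeriv u p y)) := by
      simp only [f, (extChartAt (𝓡∂ 2) p).right_inv hyt]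
    rwa [mem_preimage, hy', mem_prod] at hy
  rw [areaMeasure_apply_of_subset_source hu hU.measurableSet inter_subset_left,
    chartArea_apply u p hU.measurableSet]
  calc ∫⁻ y in T, ENNReal.ofReal (jacobian (chartDeriv u p y))
      ≤ ∫⁻ _ in T, ENNReal.ofReal C :=
        setLIntegral_mono measurable_const fun y hy => ENNReal.ofReal_le_ofReal (hT y hy).2.le
    _ ≤ ENNReal.ofReal C * volume (Metric.ball (extChartAt (𝓡∂ 2) p p) 1) := by
        rw [setLIntegral_const]
        gcongr
        exact fun y hy => (hT y hy).1
    _ < ⊤ := ENNReal.mul_lt_top ENNReal.ofReal_lt_top measure_ball_lt_top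

variable [CompactSpace M]

lemma isFiniteMeasure_areaMeasure (hu : ContMDiff (𝓡∂ 2) 𝓘(ℝ, E n) 1 u) :
    IsFiniteMeasure (areaMeasure u) :=
  have := isLocallyFiniteMeasure_areaMeasure hu
  inferInstance

lemma ae_injective_du (hu : ContMDiff (𝓡∂ 2) 𝓘(ℝ, E n) 1 u) :
    ∀ᵐ q ∂(areaMeasure u), Function.Injective (du u q) := by
  set Z := {q : M | ¬ Function.Injective (du u q)}
  have hZ : MeasurableSet Z := (isOpen_injective_du hu).measurableSet.compl
  obtain ⟨t, ht⟩ := exists_finset_iUnion_extChartAt_source_eq_univ (M := M)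
  have hcover : Z = ⋃ p ∈ t, Z ∩ (extChartAt (𝓡∂ 2) p).source := by
    rw [← inter_iUnion₂, ht, inter_univ]
  change areaMeasure u Z = 0
  rw [hcover]
  refine (measure_biUnion_null_iff t.countable_toSet).2 fun p _ => ?_
  have hZp : MeasurableSet (Z ∩ (extChartAt (𝓡∂ 2) p).source) :=
    hZ.inter (isOpen_extChartAt_source p).measurableSet
  rw [areaMeasure_apply_of_subset_source hu hZp inter_subset_right, chartArea_apply u p hZp]
  refine setLIntegral_eq_zero (measurableSet_extChartAt_symm_preimage p hZp) fun y hy => ?_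
  have hy' := mt (injective_chartDeriv_iff hu hy.1.2).1 hy.1.1
  rw [(extChartAt (𝓡∂ 2) p).right_inv hy.2] at hy'
  simp [jacobian_eq_zero_of_not_injective hy']

end Area

section Projection

variable {V W : Type*} [NormedAddCommGroup V] [InnerProductSpace ℝ V] [FiniteDimensional ℝ V]
  [NormedAddCommGroup W] [InnerProductSpace ℝ W] [CompleteSpace W]

lemma isInvertible_adjoint_comp_self [CompleteSpace V] {L : V →L[ℝ] W} (hL : Function.Injective L) :
    (ContinuousLinearMap.adjoint L ∘L L).IsInvertible := by
  have hinj : Function.Injective (ContinuousLinearMap.adjoint L ∘L L) := by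
    refine (injective_iff_map_eq_zero _).2 fun v hv => (injective_iff_map_eq_zero L).1 hL v ?_
    rw [← inner_self_eq_zero (𝕜 := ℝ), ← ContinuousLinearMap.adjoint_inner_right]
    simpa using congrArg (inner ℝ v) hv
  exact ⟨(LinearEquiv.ofInjectiveEndo _ hinj).toContinuousLinearEquiv, rfl⟩

lemma starProjection_range_eq [CompleteSpace V] {L : V →L[ℝ] W} (hL : Function.Injective L) :
    (LinearMap.range (L : V →ₗ[ℝ] W)).starProjection =
      L ∘L (ContinuousLinearMap.adjoint L ∘L L).inverse ∘L ContinuousLinearMap.adjoint L := by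
  ext1 w
  refine Submodule.eq_starProjection_of_mem_of_inner_eq_zero ⟨_, rfl⟩ ?_
  rintro _ ⟨v, rfl⟩
  obtain ⟨e, he⟩ := isInvertible_adjoint_comp_self hL
  have h : ContinuousLinearMap.adjoint L (L ((ContinuousLinearMap.adjoint L ∘L L).inverse
      (ContinuousLinearMap.adjoint L w))) = ContinuousLinearMap.adjoint L w := by
    rw [← ContinuousLinearMap.comp_apply, ← he]
    simp
  simp [← ContinuousLinearMap.adjoint_inner_left, h]

lemma continuousAt_starProjection_range [CompleteSpace V] {L : V →L[ℝ] W}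
    (hL : Function.Injective L) :
    ContinuousAt (fun L : V →L[ℝ] W => (LinearMap.range (L : V →ₗ[ℝ] W)).starProjection) L := by
  have hinv : ContinuousAt (fun L : V →L[ℝ] W => (ContinuousLinearMap.adjoint L ∘L L).inverse) L :=
    ((isInvertible_adjoint_comp_self hL).contDiffAt_map_inverse (n := 0)).continuousAt.comp
      (f := fun L : V →L[ℝ] W => ContinuousLinearMap.adjoint L ∘L L)
      (ContinuousLinearMap.adjoint.continuous.clm_comp continuous_id).continuousAt
  refine (continuousAt_id.clm_comp
    (hinv.clm_comp ContinuousLinearMap.adjoint.continuous.continuousAt)).congr ?_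
  filter_upwards [ContinuousLinearMap.isOpen_injective.mem_nhds hL] with L' hL'
  exact (starProjection_range_eq hL').symm

end Projection

section TangentPlane

lemma abs_inner_starProjection_le {W : Type*} [NormedAddCommGroup W] [InnerProductSpace ℝ W]
    (K : Submodule ℝ W) [K.HasOrthogonalProjection] (w : W) :
    |inner ℝ w (K.starProjection w)| ≤ ‖w‖ ^ 2 := by
  refine (abs_real_inner_le_norm _ _).trans ?_
  rw [sq]
  exact mul_le_mul_of_nonneg_left (K.norm_starProjection_apply_le w) (norm_nonneg _)

variable {n : ℕ} {M : Type*} [TopologicalSpace M] [ChartedSpace (EuclideanHalfSpace 2) M]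

/-- The squared length of the component of `u p - x₀` that is tangent to `M`, as the quadratic form
of the orthogonal projection onto the tangent plane. -/
def tangentialNormSq (u : M → E n) (x₀ : E n) (p : M) : ℝ :=
  inner ℝ (u p - x₀) ((LinearMap.range (du u p : E 2 →ₗ[ℝ] E n)).starProjection (u p - x₀))

lemma abs_tangentialNormSq_le (u : M → E n) (x₀ : E n) (p : M) :
    |tangentialNormSq u x₀ p| ≤ ‖u p - x₀‖ ^ 2 :=
  abs_inner_starProjection_le _ _

lemma continuousOn_tangentialNormSq [IsManifold (𝓡∂ 2) 1 M] {u : M → E n}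
    (hu : ContMDiff (𝓡∂ 2) 𝓘(ℝ, E n) 1 u) (x₀ : E n) :
    ContinuousOn (tangentialNormSq u x₀) {p | Function.Injective (du u p)} := by
  intro p hp
  have hw : ContinuousAt (fun q => u q - x₀) p := (hu.continuous.sub continuous_const).continuousAt
  have hproj : ContinuousAt (fun q =>
      (LinearMap.range (du u q : E 2 →ₗ[ℝ] E n)).starProjection) p := by
    refine ((continuousAt_starProjection_range
      ((injective_chartDeriv_iff hu (mem_extChartAt_source p)).2 hp)).comp
        (f := fun q => chartDeriv u p (extChartAt (𝓡∂ 2) p q))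
        ((continuousOn_chartDeriv_extChartAt hu p).continuousAt
          (extChartAt_source_mem_nhds p))).congr ?_
    filter_upwards [extChartAt_source_mem_nhds (I := 𝓡∂ 2) p] with q hq
    simp only [Function.comp_apply, range_chartDeriv hu hq]
  exact (hw.inner (hproj.clm_apply hw)).continuousWithinAt

lemma aemeasurable_tangentialNormSq [IsManifold (𝓡∂ 2) 1 M] [CompactSpace M] [MeasurableSpace M]
    [BorelSpace M] {u : M → E n} (hu : ContMDiff (𝓡∂ 2) 𝓘(ℝ, E n) 1 u) (x₀ : E n) :
    AEMeasurable (tangentialNormSq u x₀) (areaMeasure u) := by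
  rw [← Measure.restrict_eq_self_of_ae_mem (ae_injective_du hu)]
  exact (continuousOn_tangentialNormSq hu x₀).aemeasurable (isOpen_injective_du hu).measurableSet

lemma hasFDerivAt_radial {W : Type*} [NormedAddCommGroup W] [InnerProductSpace ℝ W]
    (x₀ : W) {ψ : ℝ → ℝ} {ψ' : ℝ} {x : W} (h : HasDerivAt ψ ψ' (‖x - x₀‖ ^ 2)) :
    HasFDerivAt (fun x => ψ (‖x - x₀‖ ^ 2) • (x - x₀))
      (ψ (‖x - x₀‖ ^ 2) • ContinuousLinearMap.id ℝ W +
        ((2 * ψ') • innerSL ℝ (x - x₀)).smulRight (x - x₀)) x := by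
  have hsub : HasFDerivAt (fun x : W => x - x₀) (ContinuousLinearMap.id ℝ W) x :=
    (hasFDerivAt_id x).sub_const x₀
  refine ((h.comp_hasFDerivAt x hsub.norm_sq).smul hsub).congr_fderiv
    (ContinuousLinearMap.ext fun v => ?_)
  simp only [Function.comp_apply, map_sub, ContinuousLinearMap.comp_id, add_apply, smul_apply,
    ContinuousLinearMap.id_apply, ContinuousLinearMap.smulRight_apply, sub_apply,
    coe_innerSL_apply, nsmul_eq_mul, Nat.cast_ofNat, smul_eq_mul, add_right_inj]
  congr 1
  ring

lemma tangentialDiv_radial {u : M → E n} {p : M} (hp : Function.Injective (du u p)) (x₀ : E n)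
    {ψ : ℝ → ℝ} {ψ' : ℝ} (h : HasDerivAt ψ ψ' (‖u p - x₀‖ ^ 2)) :
    tangentialDiv u (fun x => ψ (‖x - x₀‖ ^ 2) • (x - x₀)) p =
      2 * ψ (‖u p - x₀‖ ^ 2) + 2 * ψ' * tangentialNormSq u x₀ p := by
  rw [tangentialDiv, (hasFDerivAt_radial x₀ h).fderiv, tangentialNormSq]
  set K := LinearMap.range (du u p : E 2 →ₗ[ℝ] E n) with hK
  set w := u p - x₀
  have hdecomp : ((K.starProjection ∘L (ψ (‖w‖ ^ 2) • ContinuousLinearMap.id ℝ (E n) +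
        ((2 * ψ') • innerSL ℝ w).smulRight w) : E n →L[ℝ] E n) : E n →ₗ[ℝ] E n) =
      ψ (‖w‖ ^ 2) • (K.starProjection : E n →ₗ[ℝ] E n) +
        (((2 * ψ') • innerSL ℝ w : E n →L[ℝ] ℝ) : E n →ₗ[ℝ] ℝ).smulRight
          (K.starProjection w) := by
    ext v
    simp
  have hproj : LinearMap.IsProj K (K.starProjection : E n →ₗ[ℝ] E n) :=
    ⟨fun x => K.starProjection_apply_mem x, fun x hx => Submodule.starProjection_eq_self_iff.2 hx⟩
  have hrank : Module.finrank ℝ K = 2 := by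
    rw [hK, LinearMap.finrank_range_of_inj hp, finrank_euclideanSpace_fin]
  rw [hdecomp, map_add, map_smul, hproj.trace, LinearMap.trace_smulRight, hrank]
  simp only [Nat.cast_ofNat, smul_eq_mul, ContinuousLinearMap.toLinearMap_smul,
    ContinuousLinearMap.toLinearMap_innerSL_apply, LinearMap.smul_apply, innerₛₗ_apply_apply]
  ring

end TangentPlane

section NullImage

variable {F : Type*} [NormedAddCommGroup F] [NormedSpace ℝ F] [SecondCountableTopology F]
  [MeasurableSpace F] [BorelSpace F] {f : ℝ → F} {s : Set ℝ}

lemma hausdorffMeasure_one_image_le_of_hasFDerivWithinAt_zero {K : Set ℝ} (hK : MeasurableSet K)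
    (hs : s ⊆ K) (hf : ∀ t ∈ s, HasFDerivWithinAt f (0 : ℝ →L[ℝ] F) s t)
    {δ : NNReal} (hδ : δ ≠ 0) : μH[1] (f '' s) ≤ δ * volume K := by
  rcases s.eq_empty_or_nonempty with rfl | hne
  · simp
  obtain ⟨t, A, hdisj, hmeas, hcover, happrox, hA⟩ :=
    exists_partition_approximatesLinearOn_of_hasFDerivWithinAt f s (fun _ => 0) hf
      (fun _ => δ) fun _ => hδ
  have hlip : ∀ k, LipschitzOnWith δ f (s ∩ t k) := fun k => by
    obtain ⟨y, -, hy⟩ := hA hne k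
    refine LipschitzOnWith.of_dist_le_mul fun a ha b hb => ?_
    simpa [hy, dist_eq_norm] using happrox k a ha b hb
  calc μH[1] (f '' s) ≤ μH[1] (⋃ k, f '' (s ∩ t k)) := by
        rw [← image_iUnion, ← inter_iUnion, inter_eq_left.2 hcover]
    _ ≤ ∑' k, μH[1] (f '' (s ∩ t k)) := measure_iUnion_le _
    _ ≤ ∑' k, δ * volume (K ∩ t k) := by
        refine ENNReal.tsum_le_tsum fun k =>
          ((hlip k).hausdorffMeasure_image_le zero_le_one).trans ?_
        rw [ENNReal.rpow_one, hausdorffMeasure_real]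
        gcongr
    _ = δ * volume (⋃ k, K ∩ t k) := by
        rw [ENNReal.tsum_mul_left, measure_iUnion (fun i j h => ((hdisj h).mono
          inter_subset_right inter_subset_right)) fun k => hK.inter (hmeas k)]
    _ ≤ δ * volume K := by
        gcongr
        exact iUnion_subset fun k => inter_subset_left

lemma hausdorffMeasure_one_image_eq_zero_of_hasDerivWithinAt_zero
    (hf : ∀ t ∈ s, HasDerivWithinAt f 0 s t) : μH[1] (f '' s) = 0 := by
  have hf' : ∀ t ∈ s, HasFDerivWithinAt f (0 : ℝ →L[ℝ] F) s t := fun t ht => by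
    simpa using (hf t ht).hasFDerivWithinAt
  rw [← inter_univ s, ← iUnion_Icc_intCast ℝ, inter_iUnion, image_iUnion, measure_iUnion_null_iff]
  refine fun k => nonpos_iff_eq_zero.1 (ENNReal.le_of_forall_pos_le_add fun δ hδ _ => ?_)
  simpa using hausdorffMeasure_one_image_le_of_hasFDerivWithinAt_zero
    (measurableSet_Icc (a := (k : ℝ)) (b := k + 1)) inter_subset_right
    (fun t ht => (hf' t ht.1).mono inter_subset_left) hδ.ne'

end NullImage

section Boundary

variable {n : ℕ} {M : Type*} [TopologicalSpace M] [ChartedSpace (EuclideanHalfSpace 2) M]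

lemma extChartAt_apply_zero_nonneg (p x : M) : 0 ≤ extChartAt (𝓡∂ 2) p x 0 :=
  (range_modelWithCornersEuclideanHalfSpace 2).le (mem_range_self (chartAt _ p x))

variable [IsManifold (𝓡∂ 2) 1 M] {u : M → E n} {p q x : M}

lemma extChartAt_apply_zero_of_mem_bdry (hx : x ∈ bdry M)
    (hp : x ∈ (extChartAt (𝓡∂ 2) p).source) : extChartAt (𝓡∂ 2) p x 0 = 0 := by
  by_contra h
  rw [extChartAt_source] at hp
  have hinterior : x ∈ (𝓡∂ 2).interior M :=
    ((𝓡∂ 2).isInteriorPoint_iff_of_mem_atlas one_ne_zero (chart_mem_atlas _ p) hp).2 <|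
      (chartAt _ p).mem_interior_extend_target ((chartAt _ p).map_source hp) <|
        (interior_range_modelWithCornersEuclideanHalfSpace 2).ge <|
          (extChartAt_apply_zero_nonneg p x).lt_of_ne' h
  exact ((𝓡∂ 2).disjoint_interior_boundary.le_bot ⟨hinterior, hx⟩)

lemma eq_smul_single_one_of_apply_zero {v : E 2} (hv : v 0 = 0) :
    v = v 1 • EuclideanSpace.single 1 1 := by
  ext i
  fin_cases i <;> simp [hv]

lemma add_smul_single_one_mem_range {y : E 2} (hy : y ∈ range (𝓡∂ 2)) (t : ℝ) :
    y + t • EuclideanSpace.single 1 1 ∈ range (𝓡∂ 2) := by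
  rw [range_modelWithCornersEuclideanHalfSpace] at hy ⊢
  simpa using hy

lemma hasDerivAt_add_smul_single_one {F : Type*} [NormedAddCommGroup F] [NormedSpace ℝ F]
    {f : E 2 → F} {f' : E 2 →L[ℝ] F} {y : E 2} (hy : y ∈ range (𝓡∂ 2)) {t : ℝ}
    (hf : HasFDerivWithinAt f f' (range (𝓡∂ 2)) (y + t • EuclideanSpace.single 1 1)) :
    HasDerivAt (fun t : ℝ => f (y + t • EuclideanSpace.single 1 1))
      (f' (EuclideanSpace.single 1 1)) t := by
  have hline : HasDerivAt (fun t : ℝ => y + t • (EuclideanSpace.single 1 1 : E 2))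
      (EuclideanSpace.single 1 1) t := by
    simpa using ((hasDerivAt_id t).smul_const (EuclideanSpace.single 1 1 : E 2)).const_add y
  rw [← hasDerivWithinAt_univ] at hline ⊢
  exact hf.comp_hasDerivWithinAt t hline fun t _ => add_smul_single_one_mem_range hy t

-- The first coordinate of a transition map is minimal at every boundary point.
lemma tangentCoordChange_single_one_apply_zero (hx : x ∈ bdry M)
    (hp : x ∈ (extChartAt (𝓡∂ 2) p).source) (hq : x ∈ (extChartAt (𝓡∂ 2) q).source) :
    tangentCoordChange (𝓡∂ 2) p q x (EuclideanSpace.single 1 1) 0 = 0 := by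
  have hderiv := hasDerivAt_add_smul_single_one
    (extChartAt_target_subset_range p ((extChartAt (𝓡∂ 2) p).map_source hp))
    (f := extChartAt (𝓡∂ 2) q ∘ (extChartAt (𝓡∂ 2) p).symm) (t := 0) (by
      rw [zero_smul, add_zero]
      exact hasFDerivWithinAt_tangentCoordChange (I := 𝓡∂ 2) ⟨hp, hq⟩)
  have hcoord := (EuclideanSpace.proj (𝕜 := ℝ) (0 : Fin 2)).hasFDerivAt.comp_hasDerivAt _ hderiv
  refine IsLocalMin.hasDerivAt_eq_zero (Eventually.of_forall fun t => ?_) hcoord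
  refine le_of_eq_of_le ?_ (extChartAt_apply_zero_nonneg q _)
  simp only [Function.comp_apply, zero_smul, add_zero, EuclideanSpace.coe_proj,
    (extChartAt (𝓡∂ 2) p).left_inv hp, extChartAt_apply_zero_of_mem_bdry hx hq]

lemma exists_chartDeriv_single_one_eq_smul (hu : ContMDiff (𝓡∂ 2) 𝓘(ℝ, E n) 1 u) (hx : x ∈ bdry M)
    (hp : x ∈ (extChartAt (𝓡∂ 2) p).source) :
    ∃ c : ℝ, c ≠ 0 ∧ chartDeriv u p (extChartAt (𝓡∂ 2) p x) (EuclideanSpace.single 1 1) =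
      c • du u x (EuclideanSpace.single 1 1) := by
  have hxx := mem_extChartAt_source (I := 𝓡∂ 2) x
  set v := tangentCoordChange (𝓡∂ 2) p x x (EuclideanSpace.single 1 1) with hv
  have hv1 := eq_smul_single_one_of_apply_zero
    (tangentCoordChange_single_one_apply_zero hx hp hxx)
  rw [← hv] at hv1
  refine ⟨v 1, fun h => ?_, ?_⟩
  · rw [h, zero_smul, hv, map_eq_zero_iff _ (injective_tangentCoordChange hp hxx)] at hv1
    simpa using congrArg (fun w : E 2 => w 1) hv1
  · rw [← chartDeriv_comp_tangentCoordChange hu hp hxx, ContinuousLinearMap.comp_apply, ← hv, hv1,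
      map_smul, chartDeriv_extChartAt_self hu]
    simp

lemma isOpen_du_single_one_ne_zero (hu : ContMDiff (𝓡∂ 2) 𝓘(ℝ, E n) 1 u) :
    IsOpen {p : bdry M | du u p (EuclideanSpace.single 1 1) ≠ 0} := by
  refine isOpen_iff_mem_nhds.2 fun p hp => ?_
  have hcont : ContinuousAt (fun q : M =>
      chartDeriv u p (extChartAt (𝓡∂ 2) (p : M) q) (EuclideanSpace.single 1 1)) p :=
    ((continuousOn_chartDeriv_extChartAt hu p).continuousAt
      (extChartAt_source_mem_nhds (p : M))).clm_apply continuousAt_const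
  have hne := hcont.eventually_ne (y := 0) (by rwa [chartDeriv_extChartAt_self hu])
  filter_upwards [continuousAt_subtype_val.eventually hne,
    continuousAt_subtype_val.eventually (extChartAt_source_mem_nhds (I := 𝓡∂ 2) (p : M))]
    with q hq hqp
  obtain ⟨c, -, hc⟩ := exists_chartDeriv_single_one_eq_smul hu q.2 hqp
  exact right_ne_zero_of_smul (hc ▸ hq)

lemma ae_du_single_one_ne_zero [CompactSpace M] [MeasurableSpace M] [BorelSpace M]
    (hu : ContMDiff (𝓡∂ 2) 𝓘(ℝ, E n) 1 u) :
    ∀ᵐ p : bdry M ∂(bdryMeasure u), du u p (EuclideanSpace.single 1 1) ≠ 0 := by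
  obtain ⟨t, ht⟩ := exists_finset_iUnion_extChartAt_source_eq_univ (M := M)
  set A : M → Set ℝ := fun p =>
    {s | s • EuclideanSpace.single 1 1 ∈ (extChartAt (𝓡∂ 2) p).target ∧
      chartDeriv u p (s • EuclideanSpace.single 1 1) (EuclideanSpace.single 1 1) = 0}
  set γ : M → ℝ → E n := fun p s =>
    u ((extChartAt (𝓡∂ 2) p).symm (s • EuclideanSpace.single 1 1))
  have hnull : ∀ p, μH[1] (γ p '' A p) = 0 := fun p => by
    refine hausdorffMeasure_one_image_eq_zero_of_hasDerivWithinAt_zero fun s hs => ?_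
    have h := hasDerivAt_add_smul_single_one (y := 0) (t := s) ⟨0, rfl⟩ (by
      rw [zero_add]
      exact hasFDerivWithinAt_chartDeriv hu hs.1)
    simp only [zero_add, hs.2] at h
    exact h.hasDerivWithinAt
  have hmeas := (isOpen_du_single_one_ne_zero hu).measurableSet.compl
  refine nonpos_iff_eq_zero.1 ((Measure.comap_apply_le _ _ hmeas.nullMeasurableSet).trans ?_)
  refine (measure_mono_null ?_ ((measure_biUnion_null_iff t.countable_toSet).2
    fun p _ => hnull p)).le
  rintro _ ⟨q, hq, rfl⟩
  obtain ⟨p, hpt, hqp⟩ := mem_iUnion₂.1 (ht.ge (mem_univ (q : M)))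
  obtain ⟨c, -, hc⟩ := exists_chartDeriv_single_one_eq_smul hu q.2 hqp
  have hline := eq_smul_single_one_of_apply_zero (extChartAt_apply_zero_of_mem_bdry q.2 hqp)
  refine mem_iUnion₂.2 ⟨p, hpt, extChartAt (𝓡∂ 2) p q 1, ?_, ?_⟩
  · simp only [A, mem_ofPred_eq, ← hline]
    exact ⟨(extChartAt (𝓡∂ 2) p).map_source hqp, by rw [hc, not_not.1 hq, smul_zero]⟩
  · simp only [γ, ← hline, (extChartAt (𝓡∂ 2) p).left_inv hqp]

end Boundary

section AngularMeasure

variable {n : ℕ}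

lemma parallelogramArea_nonneg (v w : E n) : 0 ≤ parallelogramArea v w := Real.sqrt_nonneg _

lemma parallelogramArea_smul_right (v w : E n) (t : ℝ) :
    parallelogramArea v (t • w) = |t| * parallelogramArea v w := by
  rw [parallelogramArea, parallelogramArea, norm_smul, inner_smul_right, ← Real.sqrt_sq_eq_abs,
    ← Real.sqrt_mul (sq_nonneg t), Real.norm_eq_abs, mul_pow, sq_abs]
  congr 1
  ring

lemma parallelogramArea_normalize_smul (v w : E n) {c : ℝ} (hc : c ≠ 0) :
    parallelogramArea v (‖c • w‖⁻¹ • c • w) = parallelogramArea v (‖w‖⁻¹ • w) := by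
  have hc' : |c| ≠ 0 := abs_ne_zero.2 hc
  simp only [parallelogramArea_smul_right, norm_smul, Real.norm_eq_abs, abs_inv, abs_mul, abs_abs,
    abs_norm, mul_inv]
  field_simp

lemma norm_sub_inner_smul_eq_parallelogramArea (w : E n) {τ : E n} (hτ : ‖τ‖ = 1) :
    ‖w - inner ℝ w τ • τ‖ = parallelogramArea w τ := by
  rw [parallelogramArea, hτ, ← Real.sqrt_sq (norm_nonneg (w - inner ℝ w τ • τ)),
    norm_sub_sq_real, inner_smul_right, norm_smul, hτ, mul_one, Real.norm_eq_abs, sq_abs]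
  congr 1
  ring

lemma continuous_parallelogramArea : Continuous fun v : E n × E n => parallelogramArea v.1 v.2 := by
  unfold parallelogramArea
  fun_prop

variable {M : Type*} [TopologicalSpace M] [ChartedSpace (EuclideanHalfSpace 2) M] {u : M → E n}

lemma abs_inner_conormal_le {p : M} (hp : du u p (EuclideanSpace.single 1 1) ≠ 0) (w : E n) :
    |inner ℝ w (conormal u p)| ≤ parallelogramArea w (unitTangent u p) := by
  have hτ : ‖unitTangent u p‖ = 1 := norm_smul_inv_norm (𝕜 := ℝ) hp
  have hperp : inner ℝ (unitTangent u p) (conormal u p) = 0 := by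
    rw [conormal, inner_smul_right, outwardVector, inner_neg_right, inner_sub_right,
      inner_smul_right, real_inner_self_eq_norm_sq, hτ, real_inner_comm]
    ring
  have hν : ‖conormal u p‖ ≤ 1 := by
    rw [conormal, norm_smul, norm_inv, norm_norm]
    exact inv_mul_le_one
  calc |inner ℝ w (conormal u p)|
      = |inner ℝ (w - inner ℝ w (unitTangent u p) • unitTangent u p) (conormal u p)| := by
        rw [inner_sub_left, real_inner_smul_left, hperp, mul_zero, sub_zero]
    _ ≤ ‖w - inner ℝ w (unitTangent u p) • unitTangent u p‖ :=
        (abs_real_inner_le_norm _ _).trans (mul_le_of_le_one_right (norm_nonneg _) hν)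
    _ = parallelogramArea w (unitTangent u p) := norm_sub_inner_smul_eq_parallelogramArea w hτ

/-- The density, with respect to arc length on `Γ`, of the length of the radial projection of `Γ`
onto the unit sphere centred at `x₀`. -/
def angularDensity (u : M → E n) (x₀ : E n) (p : M) : ℝ :=
  parallelogramArea (u p - x₀) (unitTangent u p) / ‖u p - x₀‖ ^ 2

lemma angularDensity_nonneg (u : M → E n) (x₀ : E n) (p : M) : 0 ≤ angularDensity u x₀ p :=
  div_nonneg (parallelogramArea_nonneg _ _) (sq_nonneg _)

lemma norm_sq_mul_angularDensity (u : M → E n) (x₀ : E n) (p : M) :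
    ‖u p - x₀‖ ^ 2 * angularDensity u x₀ p = parallelogramArea (u p - x₀) (unitTangent u p) := by
  rcases eq_or_ne (u p - x₀) 0 with h | h
  · simp [h, parallelogramArea]
  · exact mul_div_cancel₀ _ (by positivity)

variable [IsManifold (𝓡∂ 2) 1 M]

lemma continuousOn_parallelogramArea_unitTangent (hu : ContMDiff (𝓡∂ 2) 𝓘(ℝ, E n) 1 u) (x₀ : E n) :
    ContinuousOn (fun p : bdry M => parallelogramArea (u p - x₀) (unitTangent u p))
      {p | du u p (EuclideanSpace.single 1 1) ≠ 0} := by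
  intro p hp
  have hw : ContinuousAt (fun q : M => u q - x₀) p :=
    (hu.continuous.sub continuous_const).continuousAt
  set v : M → E n := fun q =>
    chartDeriv u p (extChartAt (𝓡∂ 2) (p : M) q) (EuclideanSpace.single 1 1) with hvdef
  have hv : ContinuousAt v p := ((continuousOn_chartDeriv_extChartAt hu p).continuousAt
    (extChartAt_source_mem_nhds (p : M))).clm_apply continuousAt_const
  have hvp : ‖v p‖ ≠ 0 := by
    simp only [hvdef, chartDeriv_extChartAt_self hu]
    exact norm_ne_zero_iff.2 hp
  have hchart : ContinuousAt (fun q : M => parallelogramArea (u q - x₀) (‖v q‖⁻¹ • v q)) p :=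
    continuous_parallelogramArea.continuousAt.comp (f := fun q => (u q - x₀, ‖v q‖⁻¹ • v q))
      (hw.prodMk ((hv.norm.inv₀ hvp).smul hv))
  refine ((hchart.comp (f := Subtype.val) continuousAt_subtype_val).congr
    ?_).continuousWithinAt
  filter_upwards [continuousAt_subtype_val.eventually
    (extChartAt_source_mem_nhds (I := 𝓡∂ 2) (p : M))] with q hq
  obtain ⟨c, hc, hcq⟩ := exists_chartDeriv_single_one_eq_smul hu q.2 hq
  simp only [Function.comp_apply, hvdef, hcq]
  exact parallelogramArea_normalize_smul _ _ hc

variable [CompactSpace M] [MeasurableSpace M] [BorelSpace M]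

lemma aemeasurable_angularDensity (hu : ContMDiff (𝓡∂ 2) 𝓘(ℝ, E n) 1 u) (x₀ : E n) :
    AEMeasurable (fun p : bdry M => angularDensity u x₀ p) (bdryMeasure u) := by
  refine AEMeasurable.div ?_ ((((hu.continuous.comp continuous_subtype_val).sub
    continuous_const).norm.pow 2).measurable.aemeasurable)
  rw [← Measure.restrict_eq_self_of_ae_mem (ae_du_single_one_ne_zero hu)]
  exact (continuousOn_parallelogramArea_unitTangent hu x₀).aemeasurable
    (isOpen_du_single_one_ne_zero hu).measurableSet

end AngularMeasure

section RadialWeight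

lemma exists_seq_continuous_tendsto_indicator {X : Type*} [PseudoMetricSpace X] {U : Set X}
    (hU : IsOpen U) : ∃ g : ℕ → X → ℝ, (∀ j, Continuous (g j)) ∧
      (∀ j x, 0 ≤ g j x ∧ g j x ≤ U.indicator 1 x) ∧
      ∀ x, Tendsto (fun j => g j x) atTop (𝓝 (U.indicator 1 x)) := by
  have hclosed : IsClosed Uᶜ := hU.isClosed_compl
  refine ⟨fun j x => 1 - (hclosed.apprSeq j x : ℝ), fun j => by fun_prop, fun j x => ?_,
    fun x => ?_⟩
  · have hle : (hclosed.apprSeq j x : ℝ) ≤ 1 :=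
      mod_cast HasOuterApproxClosed.apprSeq_apply_le_one hclosed j x
    refine ⟨sub_nonneg.2 hle, ?_⟩
    by_cases hx : x ∈ U
    · simp [hx]
    · simp [hx, HasOuterApproxClosed.apprSeq_apply_eq_one hclosed j (mem_compl hx)]
  · have hlim := tendsto_pi_nhds.1 (HasOuterApproxClosed.tendsto_apprSeq hclosed) x
    have hlim' := (NNReal.continuous_coe.tendsto _).comp hlim
    have hcompl : U.indicator 1 x = 1 - ((Uᶜ.indicator (fun _ => 1) x : NNReal) : ℝ) := by
      by_cases hx : x ∈ U <;> simp [hx]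
    exact hcompl ▸ hlim'.const_sub 1

/-- The weight `s ↦ (max a s)⁻¹ - b⁻¹`, cut off at `s = b`. Its argument is a squared distance. -/
def radialWeight (a b s : ℝ) : ℝ := max ((max a s)⁻¹ - b⁻¹) 0

/-- The `C¹` approximation of `radialWeight a b` obtained by multiplying its derivative with a
continuous function `g` supported in `(a, b)`. -/
def smoothWeight (g : ℝ → ℝ) (a b s : ℝ) : ℝ := ∫ v in s..b, g v / max a v ^ 2

variable {a b : ℝ} {g : ℝ → ℝ}

lemma radialWeight_nonneg (a b s : ℝ) : 0 ≤ radialWeight a b s := le_max_right _ _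

lemma continuous_radialWeight (ha : 0 < a) (b : ℝ) : Continuous (radialWeight a b) :=
  (((continuous_const.max continuous_id).inv₀ fun s =>
    (ha.trans_le (le_max_left a s)).ne').sub continuous_const).max continuous_const

lemma radialWeight_le (ha : 0 < a) (hab : a < b) (s : ℝ) : radialWeight a b s ≤ a⁻¹ - b⁻¹ :=
  max_le (sub_le_sub_right (inv_anti₀ ha (le_max_left _ _)) _)
    (sub_nonneg.2 (inv_anti₀ ha hab.le))

lemma radialWeight_of_le (ha : 0 < a) (hab : a < b) {s : ℝ} (hs : b ≤ s) :
    radialWeight a b s = 0 :=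
  max_eq_right (sub_nonpos.2 (inv_anti₀ (ha.trans hab) (hs.trans (le_max_right _ _))))

lemma mul_radialWeight (ha : 0 < a) (hab : a < b) (s : ℝ) :
    s * radialWeight a b s = max (1 - s / b) 0 - max (1 - s / a) 0 := by
  have hb := ha.trans hab
  rcases le_or_gt s a with hsa | hsa
  · rw [radialWeight, max_eq_left hsa, max_eq_left (sub_nonneg.2 (inv_anti₀ ha hab.le)),
      max_eq_left (sub_nonneg.2 ((div_le_one hb).2 (hsa.trans hab.le))),
      max_eq_left (sub_nonneg.2 ((div_le_one ha).2 hsa))]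
    ring
  have hs := ha.trans hsa
  rw [radialWeight, max_eq_right hsa.le, max_eq_right (sub_nonpos.2 ((one_le_div ha).2 hsa.le)),
    mul_max_of_nonneg _ _ hs.le, mul_sub, mul_inv_cancel₀ hs.ne', mul_zero, sub_zero,
    div_eq_mul_inv]

lemma integrableOn_inv_sq_Ioo (ha : 0 < a) (b : ℝ) :
    IntegrableOn (fun v : ℝ => (v ^ 2)⁻¹) (Ioo a b) := by
  have hcont : ContinuousOn (fun v : ℝ => (v ^ 2)⁻¹) (Icc a b) := fun v hv =>
    ((continuousAt_id.pow 2).inv₀ (pow_ne_zero 2 (ha.trans_le hv.1).ne')).continuousWithinAt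
  exact hcont.integrableOn_Icc.mono_set Ioo_subset_Icc_self

lemma radialWeight_eq_setIntegral (ha : 0 < a) (hab : a < b) (s : ℝ) :
    radialWeight a b s = ∫ v in Ioo (max a s) b, (v ^ 2)⁻¹ := by
  have hm : 0 < max a s := ha.trans_le (le_max_left _ _)
  rcases le_total b (max a s) with h | h
  · rw [Ioo_eq_empty h.not_gt, setIntegral_empty]
    exact max_eq_right (sub_nonpos.2 (inv_anti₀ (ha.trans hab) h))
  · have hmem : (0 : ℝ) ∉ uIcc (max a s) b := fun h0 => by
      rw [uIcc_of_le h] at h0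
      exact hm.not_ge h0.1
    rw [← integral_Ioc_eq_integral_Ioo, ← intervalIntegral.integral_of_le h, radialWeight,
      max_eq_left (sub_nonneg.2 (inv_anti₀ hm h))]
    rw [intervalIntegral.integral_eq_sub_of_hasDerivAt (f := fun v => -v⁻¹)
      (fun v hv => (hasDerivAt_inv (ne_of_mem_of_not_mem hv hmem)).neg.congr_deriv (neg_neg _))
      (ContinuousOn.intervalIntegrable fun v hv => ((continuousAt_id.pow 2).inv₀
        (pow_ne_zero 2 (ne_of_mem_of_not_mem hv hmem))).continuousWithinAt)]
    ring

lemma hasDerivAt_smoothWeight (ha : 0 < a) (hg : Continuous g) (b s : ℝ) :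
    HasDerivAt (smoothWeight g a b) (-(g s / max a s ^ 2)) s := by
  have hcont : Continuous fun v => g v / max a v ^ 2 :=
    hg.div (by fun_prop) fun v => pow_ne_zero 2 (ha.trans_le (le_max_left a v)).ne'
  exact intervalIntegral.integral_hasDerivAt_left (hcont.intervalIntegrable _ _)
    (hcont.stronglyMeasurableAtFilter _ _) hcont.continuousAt

lemma contDiff_smoothWeight (ha : 0 < a) (hg : Continuous g) (b : ℝ) :
    ContDiff ℝ 1 (smoothWeight g a b) := by
  refine contDiff_one_iff_deriv.2
    ⟨fun s => (hasDerivAt_smoothWeight ha hg b s).differentiableAt, ?_⟩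
  rw [funext fun s => (hasDerivAt_smoothWeight ha hg b s).deriv]
  exact (hg.div (by fun_prop) fun v => pow_ne_zero 2 (ha.trans_le (le_max_left a v)).ne').neg

lemma smoothWeight_eq_setIntegral
    (hg : ∀ v, 0 ≤ g v ∧ g v ≤ (Ioo a b).indicator 1 v) (s : ℝ) :
    smoothWeight g a b s = ∫ v in Ioo (max a s) b, g v * (v ^ 2)⁻¹ := by
  have hzero : ∀ v, v ∉ Ioo a b → g v = 0 := fun v hv =>
    le_antisymm (by simpa only [indicator_of_notMem hv] using (hg v).2) (hg v).1
  have hcongr : ∀ v ∈ Ioo (max a s) b, g v * (v ^ 2)⁻¹ = g v / max a v ^ 2 := fun v hv => by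
    rw [max_eq_right ((le_max_left a s).trans hv.1.le), div_eq_mul_inv]
  rw [setIntegral_congr_fun measurableSet_Ioo hcongr, smoothWeight]
  rcases le_total b s with h | h
  · rw [Ioo_eq_empty (h.trans (le_max_right a s)).not_gt, setIntegral_empty,
      intervalIntegral.integral_of_ge h, setIntegral_eq_zero_of_forall_eq_zero, neg_zero]
    exact fun v hv => by rw [hzero v fun hv' => hv'.2.not_gt hv.1, zero_div]
  · rw [intervalIntegral.integral_of_le h]
    refine (setIntegral_eq_of_subset_of_forall_sdiff_eq_zero measurableSet_Ioc
      (fun v hv => ⟨(le_max_right a s).trans_lt hv.1, hv.2.le⟩) fun v hv => ?_)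
    rw [hzero v fun hv' => hv.2 ⟨max_lt hv'.1 hv.1.1, hv'.2⟩, zero_div]

lemma smoothWeight_nonneg (hg : ∀ v, 0 ≤ g v ∧ g v ≤ (Ioo a b).indicator 1 v) (s : ℝ) :
    0 ≤ smoothWeight g a b s := by
  rw [smoothWeight_eq_setIntegral hg]
  exact integral_nonneg fun v => mul_nonneg (hg v).1 (inv_nonneg.2 (sq_nonneg v))

lemma norm_mul_inv_sq_le (hg : ∀ v, 0 ≤ g v ∧ g v ≤ (Ioo a b).indicator 1 v) (v : ℝ) :
    ‖g v * (v ^ 2)⁻¹‖ ≤ (v ^ 2)⁻¹ := by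
  have hv : 0 ≤ (v ^ 2)⁻¹ := inv_nonneg.2 (sq_nonneg v)
  rw [Real.norm_of_nonneg (mul_nonneg (hg v).1 hv)]
  exact mul_le_of_le_one_left hv
    ((hg v).2.trans (indicator_le_self' (fun _ _ => zero_le_one) v))

lemma smoothWeight_le_radialWeight (ha : 0 < a) (hab : a < b)
    (hg : ∀ v, 0 ≤ g v ∧ g v ≤ (Ioo a b).indicator 1 v) (s : ℝ) :
    smoothWeight g a b s ≤ radialWeight a b s := by
  rw [smoothWeight_eq_setIntegral hg, radialWeight_eq_setIntegral ha hab]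
  exact (le_abs_self _).trans (norm_integral_le_of_norm_le
    (integrableOn_inv_sq_Ioo (ha.trans_le (le_max_left a s)) b)
    (Eventually.of_forall (norm_mul_inv_sq_le hg)))

lemma tendsto_smoothWeight {g : ℕ → ℝ → ℝ} (ha : 0 < a) (hab : a < b)
    (hcont : ∀ j, Continuous (g j)) (hg : ∀ j v, 0 ≤ g j v ∧ g j v ≤ (Ioo a b).indicator 1 v)
    (hlim : ∀ v, Tendsto (fun j => g j v) atTop (𝓝 ((Ioo a b).indicator 1 v))) (s : ℝ) :
    Tendsto (fun j => smoothWeight (g j) a b s) atTop (𝓝 (radialWeight a b s)) := by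
  simp only [smoothWeight_eq_setIntegral (hg _), radialWeight_eq_setIntegral ha hab]
  refine tendsto_integral_of_dominated_convergence (fun v => (v ^ 2)⁻¹)
    (fun j => ((hcont j).measurable.mul (by fun_prop)).aestronglyMeasurable)
    (integrableOn_inv_sq_Ioo (ha.trans_le (le_max_left a s)) b)
    (fun j => Eventually.of_forall (norm_mul_inv_sq_le (hg j))) ?_
  filter_upwards [ae_restrict_mem measurableSet_Ioo] with v hv
  have hmem : v ∈ Ioo a b := ⟨(le_max_left a s).trans_lt hv.1, hv.2⟩
  simpa only [indicator_of_mem hmem, Pi.one_apply, one_mul] using (hlim v).mul_const (v ^ 2)⁻¹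

lemma radialWeight_sub_mul_indicator (ha : 0 < a) (hab : a < b) (s : ℝ) :
    radialWeight a b s - s * ((Ioo a b).indicator 1 s / max a s ^ 2) =
      (Iic a).indicator (fun _ => a⁻¹) s - (Iio b).indicator (fun _ => b⁻¹) s := by
  rcases le_or_gt s a with hsa | hsa
  · have hinv : b⁻¹ ≤ a⁻¹ := inv_anti₀ ha hab.le
    simp [radialWeight, hsa, hsa.not_gt, hsa.trans_lt hab, hinv]
  have hs := ha.trans hsa
  rcases lt_or_ge s b with hsb | hsb
  · have hinv : b⁻¹ ≤ s⁻¹ := inv_anti₀ hs hsb.le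
    rw [radialWeight, max_eq_right hsa.le, max_eq_left (sub_nonneg.2 hinv),
      indicator_of_mem (show s ∈ Ioo a b from ⟨hsa, hsb⟩), Pi.one_apply,
      indicator_of_notMem (show s ∉ Iic a from hsa.not_ge),
      indicator_of_mem (show s ∈ Iio b from hsb)]
    field_simp
    ring
  · simp [radialWeight_of_le ha hab hsb, hsa.not_ge, hsb.not_gt]

lemma abs_smoothWeight_sub_le (ha : 0 < a) (hab : a < b)
    (hg : ∀ v, 0 ≤ g v ∧ g v ≤ (Ioo a b).indicator 1 v) {s : ℝ} (hs : 0 ≤ s) :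
    |smoothWeight g a b s - s * (g s / max a s ^ 2)| ≤ a⁻¹ := by
  have hψ := (smoothWeight_le_radialWeight ha hab hg s).trans (radialWeight_le ha hab s)
  have hg1 : g s ≤ 1 := (hg s).2.trans (indicator_le_self' (fun _ _ => zero_le_one) s)
  have hb : 0 ≤ b⁻¹ := inv_nonneg.2 (ha.trans hab).le
  have hsg : s * (g s / max a s ^ 2) ≤ a⁻¹ :=
    calc s * (g s / max a s ^ 2) ≤ max a s * (1 / max a s ^ 2) :=
          mul_le_mul (le_max_right a s) (div_le_div_of_nonneg_right hg1 (sq_nonneg _))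
            (div_nonneg (hg s).1 (sq_nonneg _)) (hs.trans (le_max_right a s))
      _ = (max a s)⁻¹ := by
          have : 0 < max a s := ha.trans_le (le_max_left _ _)
          field_simp
      _ ≤ a⁻¹ := inv_anti₀ ha (le_max_left a s)
  exact abs_sub_le_of_nonneg_of_le (smoothWeight_nonneg hg s) (by linarith)
    (mul_nonneg hs (div_nonneg (hg s).1 (sq_nonneg _))) hsg

lemma tendsto_integral_smoothWeight_sub {X : Type*} [MeasurableSpace X] {μ : Measure X}
    [IsFiniteMeasure μ] {s : X → ℝ} (hs : Measurable s) (hs0 : ∀ x, 0 ≤ s x) {g : ℕ → ℝ → ℝ}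
    (ha : 0 < a) (hab : a < b) (hcont : ∀ j, Continuous (g j))
    (hg : ∀ j v, 0 ≤ g j v ∧ g j v ≤ (Ioo a b).indicator 1 v)
    (hlim : ∀ v, Tendsto (fun j => g j v) atTop (𝓝 ((Ioo a b).indicator 1 v))) :
    Tendsto (fun j => ∫ x, (smoothWeight (g j) a b (s x) - s x * (g j (s x) / max a (s x) ^ 2)) ∂μ)
      atTop (𝓝 (μ.real {x | s x ≤ a} / a - μ.real {x | s x < b} / b)) := by
  have hA : MeasurableSet {x | s x ≤ a} := hs measurableSet_Iic
  have hB : MeasurableSet {x | s x < b} := hs measurableSet_Iio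
  have hlimit : ∫ x, ((Iic a).indicator (fun _ => a⁻¹) (s x) -
      (Iio b).indicator (fun _ => b⁻¹) (s x)) ∂μ =
      μ.real {x | s x ≤ a} / a - μ.real {x | s x < b} / b := by
    have hintA : ∫ x, (Iic a).indicator (fun _ => a⁻¹) (s x) ∂μ = μ.real {x | s x ≤ a} / a :=
      integral_indicator_const a⁻¹ hA
    have hintB : ∫ x, (Iio b).indicator (fun _ => b⁻¹) (s x) ∂μ = μ.real {x | s x < b} / b :=
      integral_indicator_const b⁻¹ hB
    rw [← hintA, ← hintB]
    exact integral_sub ((integrable_const a⁻¹).indicator hA) ((integrable_const b⁻¹).indicator hB)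
  rw [← hlimit]
  refine tendsto_integral_of_dominated_convergence (fun _ => a⁻¹) (fun j => ?_)
    (integrable_const _)
    (fun j => Eventually.of_forall fun x => abs_smoothWeight_sub_le ha hab (hg j) (hs0 x))
    (Eventually.of_forall fun x => ?_)
  · have hψ := (contDiff_smoothWeight ha (hcont j) b).continuous
    have hgj := (hcont j).measurable
    exact ((hψ.measurable.comp hs).sub (hs.mul ((hgj.comp hs).div
      ((measurable_const.max hs).pow_const 2)))).aestronglyMeasurable
  · rw [← radialWeight_sub_mul_indicator ha hab]
    exact (tendsto_smoothWeight ha hab hcont hg hlim (s x)).sub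
      (((hlim (s x)).div_const _).const_mul _)

end RadialWeight

section Cone

lemma setLIntegral_Ico_ofReal_abs_mul {a b c : ℝ} (ha : 0 ≤ a) (hb : 0 ≤ b) (hc : 0 ≤ c) :
    ∫⁻ t in Ico a b, ENNReal.ofReal (|t| * c) = ENNReal.ofReal ((b ^ 2 - a ^ 2) / 2 * c) := by
  rcases le_total b a with hba | hab
  · have hsq : (b ^ 2 - a ^ 2) / 2 * c ≤ 0 :=
      mul_nonpos_of_nonpos_of_nonneg (by linarith [pow_le_pow_left₀ hb hba 2]) hc
    rw [Ico_eq_empty hba.not_gt, setLIntegral_empty, ENNReal.ofReal_of_nonpos hsq]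
  have habs : ∀ t ∈ Ioc a b, ENNReal.ofReal (|t| * c) = ENNReal.ofReal (t * c) := fun t ht => by
    rw [abs_of_nonneg (ha.trans ht.1.le)]
  rw [setLIntegral_congr Ico_ae_eq_Ioc, setLIntegral_congr_fun measurableSet_Ioc habs,
    ← ofReal_integral_eq_lintegral_ofReal (Continuous.integrableOn_Ioc (by fun_prop)),
    ← intervalIntegral.integral_of_le hab, intervalIntegral.integral_mul_const, integral_id]
  filter_upwards [ae_restrict_mem measurableSet_Ioc] with t ht
  exact mul_nonneg (ha.trans ht.1.le) hc

variable {n : ℕ}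

lemma add_smul_mem_ball_iff (x₀ : E n) {v : E n} (hv : v ≠ 0) {t : ℝ} (ht : 0 ≤ t) (r : ℝ) :
    x₀ + t • v ∈ Metric.ball x₀ r ↔ t < r / ‖v‖ := by
  rw [mem_ball_iff_norm, add_sub_cancel_left, norm_smul, Real.norm_of_nonneg ht,
    lt_div_iff₀ (norm_pos_iff.2 hv)]

lemma lintegral_coneSlice_Ici (x₀ v τ : E n) {r : ℝ} (hr : 0 < r) :
    ∫⁻ t in {t : ℝ | t ∈ Ici 1 ∧ x₀ + t • v ∈ Metric.ball x₀ r},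
      ENNReal.ofReal (parallelogramArea v (t • τ)) =
    ENNReal.ofReal (r ^ 2 / 2) * (ENNReal.ofReal (parallelogramArea v τ / ‖v‖ ^ 2) *
      ENNReal.ofReal (1 - ‖v‖ ^ 2 / r ^ 2)) := by
  rcases eq_or_ne v 0 with rfl | hv
  · simp [parallelogramArea]
  have := norm_pos_iff.2 hv
  have hslice : {t : ℝ | t ∈ Ici 1 ∧ x₀ + t • v ∈ Metric.ball x₀ r} = Ico 1 (r / ‖v‖) := by
    ext t
    exact and_congr_right fun ht => add_smul_mem_ball_iff x₀ hv (zero_le_one.trans ht) r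
  simp_rw [hslice, parallelogramArea_smul_right]
  rw [setLIntegral_Ico_ofReal_abs_mul zero_le_one (by positivity) (parallelogramArea_nonneg v τ),
    ← ENNReal.ofReal_mul (div_nonneg (parallelogramArea_nonneg v τ) (by positivity)),
    ← ENNReal.ofReal_mul (by positivity)]
  congr 1
  field_simp

lemma lintegral_coneSlice_Icc (x₀ v τ : E n) {r : ℝ} (hr : 0 < r) :
    ∫⁻ t in {t : ℝ | t ∈ Icc 0 1 ∧ x₀ + t • v ∈ Metric.ball x₀ r},
      ENNReal.ofReal (parallelogramArea v (t • τ)) =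
    ENNReal.ofReal (r ^ 2 / 2) * (ENNReal.ofReal (parallelogramArea v τ / ‖v‖ ^ 2) *
      ENNReal.ofReal (min 1 (‖v‖ ^ 2 / r ^ 2))) := by
  rcases eq_or_ne v 0 with rfl | hv
  · simp [parallelogramArea]
  have hnorm := norm_pos_iff.2 hv
  have hslice : {t : ℝ | t ∈ Icc 0 1 ∧ x₀ + t • v ∈ Metric.ball x₀ r} =
      Icc 0 1 ∩ Ico 0 (r / ‖v‖) := by
    ext t
    refine and_congr_right fun ht => ?_
    rw [add_smul_mem_ball_iff x₀ hv ht.1 r, mem_Ico, and_iff_right ht.1]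
  have hslice_ae : (Icc 0 1 ∩ Ico 0 (r / ‖v‖) : Set ℝ) =ᵐ[volume] Ico 0 (min 1 (r / ‖v‖)) := by
    rw [← max_self (0 : ℝ), ← Ico_inter_Ico, max_self]
    exact Ico_ae_eq_Icc.symm.inter EventuallyEq.rfl
  have hmin : min 1 (r / ‖v‖) ^ 2 * ‖v‖ ^ 2 = r ^ 2 * min 1 (‖v‖ ^ 2 / r ^ 2) := by
    rcases le_total ‖v‖ r with h | h
    · rw [min_eq_left ((one_le_div hnorm).2 h),
        min_eq_right ((div_le_one (pow_pos hr 2)).2 (pow_le_pow_left₀ hnorm.le h 2))]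
      field_simp
    · rw [min_eq_right ((div_le_one hnorm).2 h),
        min_eq_left ((one_le_div (pow_pos hr 2)).2 (pow_le_pow_left₀ hr.le h 2))]
      field_simp
  simp_rw [hslice, parallelogramArea_smul_right]
  rw [setLIntegral_congr hslice_ae, setLIntegral_Ico_ofReal_abs_mul le_rfl (by positivity)
      (parallelogramArea_nonneg v τ),
    ← ENNReal.ofReal_mul (div_nonneg (parallelogramArea_nonneg v τ) (by positivity)),
    ← ENNReal.ofReal_mul (by positivity)]
  congr 1
  field_simp
  linear_combination parallelogramArea v τ * hmin

variable {M : Type*} [TopologicalSpace M] [ChartedSpace (EuclideanHalfSpace 2) M]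
  [MeasurableSpace M] {u : M → E n}

/-- The angular measure of `Γ` as seen from `x₀`: the length of the radial projection of `Γ`
onto the unit sphere around `x₀`, counted with multiplicity and transported to `∂M`. -/
def angularMeasure (u : M → E n) (x₀ : E n) : Measure (bdry M) :=
  (bdryMeasure u).withDensity fun p => ENNReal.ofReal (angularDensity u x₀ p)

variable [IsManifold (𝓡∂ 2) 1 M] [CompactSpace M] [BorelSpace M]

lemma lintegral_angularMeasure (hu : ContMDiff (𝓡∂ 2) 𝓘(ℝ, E n) 1 u) (x₀ : E n)
    (f : bdry M → ℝ≥0∞) :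
    ∫⁻ p, f p ∂(angularMeasure u x₀) =
      ∫⁻ p : bdry M, ENNReal.ofReal (angularDensity u x₀ p) * f p ∂(bdryMeasure u) :=
  lintegral_withDensity_eq_lintegral_mul_non_measurable₀ _
    (aemeasurable_angularDensity hu x₀).ennreal_ofReal
    (Eventually.of_forall fun _ => ENNReal.ofReal_lt_top) f

lemma integral_angularMeasure (hu : ContMDiff (𝓡∂ 2) 𝓘(ℝ, E n) 1 u) (x₀ : E n)
    (f : bdry M → ℝ) :
    ∫ p, f p ∂(angularMeasure u x₀) =
      ∫ p : bdry M, angularDensity u x₀ p * f p ∂(bdryMeasure u) := by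
  rw [angularMeasure, integral_withDensity_eq_integral_toReal_smul₀
    (aemeasurable_angularDensity hu x₀).ennreal_ofReal
    (Eventually.of_forall fun _ => ENNReal.ofReal_lt_top)]
  simp only [ENNReal.toReal_ofReal (angularDensity_nonneg u x₀ _), smul_eq_mul]

lemma ae_angularMeasure_ne (hu : ContMDiff (𝓡∂ 2) 𝓘(ℝ, E n) 1 u) (x₀ : E n) :
    ∀ᵐ p : bdry M ∂(angularMeasure u x₀), u p ≠ x₀ := by
  refine (ae_withDensity_iff' (aemeasurable_angularDensity hu x₀).ennreal_ofReal).2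
    (Eventually.of_forall fun p hp => ?_)
  rintro rfl
  simp [angularDensity] at hp

lemma coneArea_Ici (hu : ContMDiff (𝓡∂ 2) 𝓘(ℝ, E n) 1 u) (x₀ : E n) {r : ℝ} (hr : 0 < r) :
    coneArea u x₀ (Ici 1) r = ENNReal.ofReal (r ^ 2 / 2) *
      ∫⁻ p : bdry M, ENNReal.ofReal (1 - ‖u p - x₀‖ ^ 2 / r ^ 2) ∂(angularMeasure u x₀) := by
  simp_rw [coneArea, lintegral_coneSlice_Ici x₀ _ _ hr]
  rw [lintegral_const_mul' _ _ ENNReal.ofReal_ne_top, lintegral_angularMeasure hu]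
  rfl

lemma coneArea_Icc (hu : ContMDiff (𝓡∂ 2) 𝓘(ℝ, E n) 1 u) (x₀ : E n) {r : ℝ} (hr : 0 < r) :
    coneArea u x₀ (Icc 0 1) r = ENNReal.ofReal (r ^ 2 / 2) *
      ∫⁻ p : bdry M, ENNReal.ofReal (min 1 (‖u p - x₀‖ ^ 2 / r ^ 2)) ∂(angularMeasure u x₀) := by
  simp_rw [coneArea, lintegral_coneSlice_Icc x₀ _ _ hr]
  rw [lintegral_const_mul' _ _ ENNReal.ofReal_ne_top, lintegral_angularMeasure hu]
  rfl

lemma hasDensity_coneArea_Icc (hu : ContMDiff (𝓡∂ 2) 𝓘(ℝ, E n) 1 u) (x₀ : E n) :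
    HasDensity (coneArea u x₀ (Icc 0 1))
      (ENNReal.ofReal (2 * Real.pi)⁻¹ * angularMeasure u x₀ univ) := by
  have := Real.pi_pos
  set κ := angularMeasure u x₀
  set F : ℝ → bdry M → ℝ≥0∞ := fun r p => ENNReal.ofReal (min 1 (‖u p - x₀‖ ^ 2 / r ^ 2))
  have hF_le : ∀ r, ∫⁻ p, F r p ∂κ ≤ κ univ := fun r => by
    rw [← lintegral_one]
    exact lintegral_mono fun p => (ENNReal.ofReal_le_one).2 (min_le_left _ _)
  have hF_meas : ∀ r, Measurable (F r) := fun r => by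
    have hcont : Continuous fun p : bdry M => u p := hu.continuous.comp continuous_subtype_val
    exact (measurable_const.min (((hcont.sub continuous_const).norm.pow 2).measurable.div_const
      _)).ennreal_ofReal
  have hF_lim : ∀ p : bdry M, u p ≠ x₀ → Tendsto (fun r => F r p) (𝓝[>] 0) (𝓝 1) := fun p hp => by
    have hw : 0 < ‖u p - x₀‖ := norm_pos_iff.2 (sub_ne_zero.2 hp)
    refine tendsto_const_nhds.congr' ?_
    filter_upwards [Ioo_mem_nhdsGT hw] with r hr
    have hle : 1 ≤ ‖u p - x₀‖ ^ 2 / r ^ 2 :=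
      (one_le_div (pow_pos hr.1 2)).2 (pow_le_pow_left₀ hr.1.le hr.2.le 2)
    simp only [F, min_eq_left hle, ENNReal.ofReal_one]
  have hfatou : κ univ ≤ liminf (fun r => ∫⁻ p, F r p ∂κ) (𝓝[>] 0) := by
    refine le_trans (le_of_eq ?_) (lintegral_liminf_le hF_meas)
    rw [← lintegral_one]
    exact lintegral_congr_ae ((ae_angularMeasure_ne hu x₀).mono fun p hp =>
      (hF_lim p hp).liminf_eq.symm)
  have hlim : Tendsto (fun r => ∫⁻ p, F r p ∂κ) (𝓝[>] 0) (𝓝 (κ univ)) :=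
    tendsto_of_le_liminf_of_limsup_le hfatou (limsup_le_of_le (h := Eventually.of_forall hF_le))
  refine (ENNReal.Tendsto.const_mul hlim (Or.inr ENNReal.ofReal_ne_top)).congr' ?_
  filter_upwards [self_mem_nhdsWithin] with r (hr : 0 < r)
  rw [coneArea_Icc hu x₀ hr, ENNReal.mul_div_right_comm,
    ← ENNReal.ofReal_div_of_pos (by positivity)]
  congr 2
  field_simp

end Cone

section FirstVariation

variable {n : ℕ} {M : Type*} [TopologicalSpace M] [CompactSpace M]
  [ChartedSpace (EuclideanHalfSpace 2) M] [MeasurableSpace M] [BorelSpace M]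
  {u : M → E n} {H : M → E n} {x₀ : E n} {ψ : ℝ → ℝ}

lemma integrable_mul_norm_of_continuous {X F : Type*} [TopologicalSpace X] [CompactSpace X]
    [MeasurableSpace X] [OpensMeasurableSpace X] [NormedAddCommGroup F] {μ : Measure X}
    {φ : X → ℝ} {f : X → F} (hφ : Continuous φ) (hf : Integrable f μ) :
    Integrable (fun x => φ x * ‖f x‖) μ := by
  obtain ⟨c, hc⟩ := hφ.bounded_above_of_compact_support (HasCompactSupport.of_compactSpace _)
  exact hf.norm.bdd_mul hφ.measurable.aestronglyMeasurable (Eventually.of_forall hc)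

lemma integral_inner_radial_le (hu : Continuous u) (hH : Integrable H (areaMeasure u))
    (hψ : Continuous ψ) (hψ0 : ∀ s, 0 ≤ ψ s) :
    ∫ p, inner ℝ (ψ (‖u p - x₀‖ ^ 2) • (u p - x₀)) (H p) ∂(areaMeasure u) ≤
      ∫ p, ψ (‖u p - x₀‖ ^ 2) * ‖u p - x₀‖ * ‖H p‖ ∂(areaMeasure u) := by
  have hcont : Continuous fun p => ψ (‖u p - x₀‖ ^ 2) * ‖u p - x₀‖ := by fun_prop
  refine (Real.le_norm_self _).trans (norm_integral_le_of_norm_le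
    (integrable_mul_norm_of_continuous hcont hH) (Eventually.of_forall fun p => ?_))
  refine (norm_inner_le_norm _ _).trans_eq ?_
  rw [norm_smul, Real.norm_of_nonneg (hψ0 _)]

variable [IsManifold (𝓡∂ 2) 1 M]

lemma integrable_angularMeasure_of_continuous [IsFiniteMeasure (angularMeasure u x₀)] {φ : M → ℝ}
    (hφ : Continuous φ) : Integrable (fun p : bdry M => φ p) (angularMeasure u x₀) := by
  have : CompactSpace (bdry M) := isCompact_iff_compactSpace.1
    (ModelWithCorners.isClosed_boundary (n := 1) one_ne_zero).isCompact
  exact (hφ.comp continuous_subtype_val).integrable_of_hasCompactSupport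
    (HasCompactSupport.of_compactSpace _)

lemma integral_inner_conormal_radial_le (hu : ContMDiff (𝓡∂ 2) 𝓘(ℝ, E n) 1 u)
    [IsFiniteMeasure (angularMeasure u x₀)] (hψ : Continuous ψ) (hψ0 : ∀ s, 0 ≤ ψ s) :
    ∫ p : bdry M, inner ℝ (ψ (‖u p - x₀‖ ^ 2) • (u p - x₀)) (conormal u p) ∂(bdryMeasure u) ≤
      ∫ p : bdry M, ‖u p - x₀‖ ^ 2 * ψ (‖u p - x₀‖ ^ 2) ∂(angularMeasure u x₀) := by
  have hcont : Continuous fun p => ‖u p - x₀‖ ^ 2 * ψ (‖u p - x₀‖ ^ 2) := by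
    have := hu.continuous
    fun_prop
  have hint := integrable_angularMeasure_of_continuous (u := u) (x₀ := x₀) hcont
  rw [angularMeasure, integrable_withDensity_iff_integrable_smul₀'
    (aemeasurable_angularDensity hu x₀).ennreal_ofReal
    (Eventually.of_forall fun _ => ENNReal.ofReal_lt_top)] at hint
  simp only [ENNReal.toReal_ofReal (angularDensity_nonneg u x₀ _), smul_eq_mul] at hint
  rw [integral_angularMeasure hu]
  refine (Real.le_norm_self _).trans (norm_integral_le_of_norm_le hint ?_)
  filter_upwards [ae_du_single_one_ne_zero hu] with p hp
  rw [real_inner_smul_left, norm_mul, Real.norm_of_nonneg (hψ0 _), Real.norm_eq_abs]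
  calc ψ (‖u p - x₀‖ ^ 2) * |inner ℝ (u p - x₀) (conormal u p)|
      ≤ ψ (‖u p - x₀‖ ^ 2) * parallelogramArea (u p - x₀) (unitTangent u p) :=
        mul_le_mul_of_nonneg_left (abs_inner_conormal_le hp _) (hψ0 _)
    _ = angularDensity u x₀ p * (‖u p - x₀‖ ^ 2 * ψ (‖u p - x₀‖ ^ 2)) := by
        rw [← norm_sq_mul_angularDensity]
        ring

lemma integral_radial_le_integral_tangentialDiv (hu : ContMDiff (𝓡∂ 2) 𝓘(ℝ, E n) 1 u)
    (hψ : ContDiff ℝ 1 ψ) (hψ' : ∀ s, deriv ψ s ≤ 0) :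
    ∫ p, 2 * (ψ (‖u p - x₀‖ ^ 2) + ‖u p - x₀‖ ^ 2 * deriv ψ (‖u p - x₀‖ ^ 2)) ∂(areaMeasure u) ≤
      ∫ p, tangentialDiv u (fun x => ψ (‖x - x₀‖ ^ 2) • (x - x₀)) p ∂(areaMeasure u) := by
  have := isFiniteMeasure_areaMeasure hu
  have hcψ := hψ.continuous
  have := hψ.continuous_deriv le_rfl
  have hcu := hu.continuous
  have hdiv := (ae_injective_du hu).mono fun p hp => tangentialDiv_radial hp x₀
    ((hψ.differentiable one_ne_zero) (‖u p - x₀‖ ^ 2)).hasDerivAt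
  have hint : ∀ {f : M → ℝ}, Continuous f → Integrable f (areaMeasure u) := fun hf =>
    hf.integrable_of_hasCompactSupport (HasCompactSupport.of_compactSpace _)
  have hdom : Integrable (fun p => 2 * deriv ψ (‖u p - x₀‖ ^ 2) * tangentialNormSq u x₀ p)
      (areaMeasure u) := by
    refine (hint (f := fun p => 2 * |deriv ψ (‖u p - x₀‖ ^ 2)| * ‖u p - x₀‖ ^ 2)
      (by fun_prop)).mono' ?_ (Eventually.of_forall fun p => ?_)
    · exact ((by fun_prop : Continuous fun p => 2 * deriv ψ (‖u p - x₀‖ ^ 2)).aemeasurable.mul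
        (aemeasurable_tangentialNormSq hu x₀)).aestronglyMeasurable
    · rw [norm_mul, norm_mul, Real.norm_two, Real.norm_eq_abs]
      exact mul_le_mul_of_nonneg_left (abs_tangentialNormSq_le u x₀ p) (by positivity)
  rw [integral_congr_ae hdiv]
  refine integral_mono (hint (by fun_prop)) ((hint (by fun_prop)).add hdom) fun p => ?_
  have hs : tangentialNormSq u x₀ p ≤ ‖u p - x₀‖ ^ 2 :=
    (le_abs_self _).trans (abs_tangentialNormSq_le u x₀ p)
  nlinarith [hψ' (‖u p - x₀‖ ^ 2)]

lemma radial_firstVariation_le (hu : ContMDiff (𝓡∂ 2) 𝓘(ℝ, E n) 1 u)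
    (hH : Integrable H (areaMeasure u)) (hdiv : DivergenceIdentity u H)
    [IsFiniteMeasure (angularMeasure u x₀)]
    (hψ : ContDiff ℝ 1 ψ) (hψ0 : ∀ s, 0 ≤ ψ s) (hψ' : ∀ s, deriv ψ s ≤ 0) :
    ∫ p, 2 * (ψ (‖u p - x₀‖ ^ 2) + ‖u p - x₀‖ ^ 2 * deriv ψ (‖u p - x₀‖ ^ 2)) ∂(areaMeasure u) ≤
      ∫ p, ψ (‖u p - x₀‖ ^ 2) * ‖u p - x₀‖ * ‖H p‖ ∂(areaMeasure u) +
        ∫ p : bdry M, ‖u p - x₀‖ ^ 2 * ψ (‖u p - x₀‖ ^ 2) ∂(angularMeasure u x₀) := by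
  have hX : ContDiff ℝ 1 fun x : E n => ψ (‖x - x₀‖ ^ 2) • (x - x₀) :=
    (hψ.comp ((contDiff_id.sub contDiff_const).norm_sq ℝ)).smul (contDiff_id.sub contDiff_const)
  refine (integral_radial_le_integral_tangentialDiv hu hψ hψ').trans ?_
  rw [hdiv _ hX]
  exact add_le_add (integral_inner_radial_le hu.continuous hH hψ.continuous hψ0)
    (integral_inner_conormal_radial_le hu hψ.continuous hψ0)

end FirstVariation

section AreaRatio

variable {n : ℕ} {M : Type*} [TopologicalSpace M] [CompactSpace M]
  [ChartedSpace (EuclideanHalfSpace 2) M] [IsManifold (𝓡∂ 2) 1 M]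
  [MeasurableSpace M] [BorelSpace M] {u : M → E n} {H : M → E n} {x₀ : E n} {a b : ℝ}

lemma integral_smoothWeight_sub_le (hu : ContMDiff (𝓡∂ 2) 𝓘(ℝ, E n) 1 u)
    (hH : Integrable H (areaMeasure u)) (hdiv : DivergenceIdentity u H)
    [IsFiniteMeasure (angularMeasure u x₀)] {g : ℝ → ℝ} (ha : 0 < a) (hab : a < b)
    (hcont : Continuous g) (hg : ∀ v, 0 ≤ g v ∧ g v ≤ (Ioo a b).indicator 1 v) :
    2 * ∫ p, (smoothWeight g a b (‖u p - x₀‖ ^ 2) -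
        ‖u p - x₀‖ ^ 2 * (g (‖u p - x₀‖ ^ 2) / max a (‖u p - x₀‖ ^ 2) ^ 2)) ∂(areaMeasure u) ≤
      ∫ p, radialWeight a b (‖u p - x₀‖ ^ 2) * ‖u p - x₀‖ * ‖H p‖ ∂(areaMeasure u) +
        ∫ p : bdry M, ‖u p - x₀‖ ^ 2 * radialWeight a b (‖u p - x₀‖ ^ 2)
          ∂(angularMeasure u x₀) := by
  have hderiv : deriv (smoothWeight g a b) = fun s => -(g s / max a s ^ 2) :=
    funext fun s => (hasDerivAt_smoothWeight ha hcont b s).deriv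
  have hvar := radial_firstVariation_le (x₀ := x₀) hu hH hdiv (contDiff_smoothWeight ha hcont b)
    (smoothWeight_nonneg hg) fun s => by
      rw [hderiv]
      exact neg_nonpos.2 (div_nonneg (hg s).1 (sq_nonneg _))
  simp only [hderiv, mul_neg, ← sub_eq_add_neg] at hvar
  rw [← integral_const_mul]
  have hsmooth0 := smoothWeight_nonneg hg
  have hsmooth_le := smoothWeight_le_radialWeight ha hab hg
  have hweight : Continuous fun p => radialWeight a b (‖u p - x₀‖ ^ 2) :=
    (continuous_radialWeight ha b).comp ((hu.continuous.sub continuous_const).norm.pow 2)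
  have hnorm : Continuous fun p => ‖u p - x₀‖ := (hu.continuous.sub continuous_const).norm
  refine hvar.trans (add_le_add ?_ ?_)
  · exact integral_mono_of_nonneg
      (Eventually.of_forall fun p =>
        mul_nonneg (mul_nonneg (hsmooth0 _) (norm_nonneg _)) (norm_nonneg _))
      (integrable_mul_norm_of_continuous (hweight.mul hnorm) hH)
      (Eventually.of_forall fun p => mul_le_mul_of_nonneg_right
        (mul_le_mul_of_nonneg_right (hsmooth_le _) (norm_nonneg _)) (norm_nonneg _))
  · exact integral_mono_of_nonneg
      (Eventually.of_forall fun p => mul_nonneg (sq_nonneg _) (hsmooth0 _))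
      (integrable_angularMeasure_of_continuous ((hnorm.pow 2).mul hweight))
      (Eventually.of_forall fun p => mul_le_mul_of_nonneg_left (hsmooth_le _) (sq_nonneg _))

lemma area_div_sub_area_div_le (hu : ContMDiff (𝓡∂ 2) 𝓘(ℝ, E n) 1 u)
    (hH : Integrable H (areaMeasure u)) (hdiv : DivergenceIdentity u H)
    [IsFiniteMeasure (angularMeasure u x₀)] (ha : 0 < a) (hab : a < b) :
    2 * ((areaMeasure u).real {p | ‖u p - x₀‖ ^ 2 ≤ a} / a -
        (areaMeasure u).real {p | ‖u p - x₀‖ ^ 2 < b} / b) ≤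
      ∫ p, radialWeight a b (‖u p - x₀‖ ^ 2) * ‖u p - x₀‖ * ‖H p‖ ∂(areaMeasure u) +
        ∫ p : bdry M, ‖u p - x₀‖ ^ 2 * radialWeight a b (‖u p - x₀‖ ^ 2)
          ∂(angularMeasure u x₀) := by
  have := isFiniteMeasure_areaMeasure hu
  have hs : Continuous fun p => ‖u p - x₀‖ ^ 2 := (hu.continuous.sub continuous_const).norm.pow 2
  obtain ⟨g, hcont, hg, hlim⟩ :=
    exists_seq_continuous_tendsto_indicator (isOpen_Ioo (a := a) (b := b))
  exact le_of_tendsto' ((tendsto_integral_smoothWeight_sub hs.measurable (fun _ => sq_nonneg _)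
    ha hab hcont hg hlim).const_mul 2)
    fun j => integral_smoothWeight_sub_le hu hH hdiv ha hab (hcont j) (hg j)

end AreaRatio

section Gronwall

variable {α Λ q : ℝ} {m : ℝ → ℝ}

lemma rpow_mul_sq_sub_one_le (hα : 0 < α) (hq : 1 ≤ q) :
    α * q ^ α * (q ^ 2 - 1) / 2 ≤ q ^ α * q ^ 2 * (q ^ α - 1) := by
  have hq0 : 0 < q := zero_lt_one.trans_le hq
  have hlog : 1 - (q ^ 2)⁻¹ ≤ 2 * Real.log q := by
    simpa using Real.one_sub_inv_le_log_of_pos (pow_pos hq0 2)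
  have hpow : α * Real.log q ≤ q ^ α - 1 := by
    rw [Real.rpow_def_of_pos hq0, mul_comm (Real.log q)]
    linarith [Real.add_one_le_exp (α * Real.log q)]
  calc α * q ^ α * (q ^ 2 - 1) / 2 = q ^ α * q ^ 2 * (α * ((1 - (q ^ 2)⁻¹) / 2)) := by
        field_simp
    _ ≤ q ^ α * q ^ 2 * (α * Real.log q) := by
        gcongr
        linarith
    _ ≤ q ^ α * q ^ 2 * (q ^ α - 1) := by gcongr

lemma exp_mul_le_exp_mul_of_step (hα : 0 < α) (hΛ : 0 ≤ Λ) (hm : ∀ r, 0 < r → 0 ≤ m r)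
    (hstep : ∀ σ r, 0 < σ → σ < r → m σ ≤ (1 + α * Λ * r ^ α * ((r / σ) ^ 2 - 1) / 2) * m r)
    (hq : 1 < q) {ρ : ℝ} (hρ : 0 < ρ) :
    Real.exp (q ^ α * q ^ 2 * Λ * ρ ^ α) * m ρ ≤
      Real.exp (q ^ α * q ^ 2 * Λ * (ρ * q) ^ α) * m (ρ * q) := by
  have hq0 : 0 < q := zero_lt_one.trans hq
  have hmul : (ρ * q) ^ α = ρ ^ α * q ^ α := Real.mul_rpow hρ.le hq0.le
  have hmq := hm (ρ * q) (by positivity)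
  set c := q ^ α * q ^ 2
  have hfactor : 1 + α * Λ * (ρ * q) ^ α * ((ρ * q / ρ) ^ 2 - 1) / 2 ≤
      Real.exp (c * Λ * (ρ * q) ^ α - c * Λ * ρ ^ α) :=
    calc 1 + α * Λ * (ρ * q) ^ α * ((ρ * q / ρ) ^ 2 - 1) / 2
        = Λ * ρ ^ α * (α * q ^ α * (q ^ 2 - 1) / 2) + 1 := by
          rw [hmul, mul_div_cancel_left₀ q hρ.ne']
          ring
      _ ≤ Λ * ρ ^ α * (c * (q ^ α - 1)) + 1 := by
          gcongr
          exact rpow_mul_sq_sub_one_le hα hq.le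
      _ = (c * Λ * (ρ * q) ^ α - c * Λ * ρ ^ α) + 1 := by
          rw [hmul]
          ring
      _ ≤ _ := Real.add_one_le_exp _
  calc Real.exp (c * Λ * ρ ^ α) * m ρ
      ≤ Real.exp (c * Λ * ρ ^ α) *
          (Real.exp (c * Λ * (ρ * q) ^ α - c * Λ * ρ ^ α) * m (ρ * q)) := by
        gcongr
        exact (hstep ρ (ρ * q) hρ (lt_mul_of_one_lt_right hρ hq)).trans
          (mul_le_mul_of_nonneg_right hfactor hmq)
    _ = Real.exp (c * Λ * (ρ * q) ^ α) * m (ρ * q) := by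
        rw [← mul_assoc, ← Real.exp_add, add_sub_cancel]

-- Subdividing `[σ, r]` geometrically with ratio `q` multiplies the exponent by `q ^ α * q ^ 2`,
-- which tends to `1` as the subdivision is refined.
lemma monotoneOn_exp_mul_of_step (hα : 0 < α) (hΛ : 0 ≤ Λ) (hm : ∀ r, 0 < r → 0 ≤ m r)
    (hstep : ∀ σ r, 0 < σ → σ < r → m σ ≤ (1 + α * Λ * r ^ α * ((r / σ) ^ 2 - 1) / 2) * m r) :
    MonotoneOn (fun r => Real.exp (Λ * r ^ α) * m r) (Ioi 0) := by
  intro σ (hσ : 0 < σ) r _ hσr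
  rcases hσr.eq_or_lt with rfl | hlt
  · exact le_rfl
  have hratio : 1 < r / σ := (one_lt_div hσ).2 hlt
  have hratio0 : 0 < r / σ := zero_lt_one.trans hratio
  set q : ℕ → ℝ := fun N => (r / σ) ^ (1 / ((N : ℝ) + 1)) with hq
  have hsubdivision (N : ℕ) : Real.exp (q N ^ α * q N ^ 2 * Λ * σ ^ α) * m σ ≤
      Real.exp (q N ^ α * q N ^ 2 * Λ * r ^ α) * m r := by
    have hqN : 1 < q N := Real.one_lt_rpow hratio Nat.one_div_pos_of_nat
    have hmono : Monotone fun k : ℕ =>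
        Real.exp (q N ^ α * q N ^ 2 * Λ * (σ * q N ^ k) ^ α) * m (σ * q N ^ k) :=
      monotone_nat_of_le_succ fun k => by
        simpa only [pow_succ, mul_assoc] using exp_mul_le_exp_mul_of_step hα hΛ hm hstep hqN
          (ρ := σ * q N ^ k) (mul_pos hσ (pow_pos (zero_lt_one.trans hqN) k))
    have hend : q N ^ (N + 1) = r / σ := by
      simpa only [hq, one_div, Nat.cast_succ] using
        Real.rpow_inv_natCast_pow hratio0.le N.succ_ne_zero
    simpa only [pow_zero, mul_one, hend, mul_div_cancel₀ r hσ.ne'] using hmono (Nat.zero_le (N + 1))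
  have hlim : Tendsto q atTop (𝓝 1) := by
    simpa only [Real.rpow_zero] using (tendsto_const_nhds (x := r / σ)).rpow
      (tendsto_one_div_add_atTop_nhds_zero_nat (𝕜 := ℝ)) (Or.inl hratio0.ne')
  have hlimF (x : ℝ) : Tendsto (fun N => Real.exp (q N ^ α * q N ^ 2 * Λ * x ^ α) * m x) atTop
      (𝓝 (Real.exp (Λ * x ^ α) * m x)) := by
    simpa only [Real.one_rpow, one_pow, one_mul] using
      ((((hlim.rpow_const (Or.inl one_ne_zero)).mul (hlim.pow 2)).mul_const Λ).mul_const
        (x ^ α)).rexp.mul_const (m x)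
  exact le_of_tendsto_of_tendsto' (hlimF σ) (hlimF r) hsubdivision

end Gronwall

section MassRatio

variable {n : ℕ} {M : Type*} [TopologicalSpace M] [ChartedSpace (EuclideanHalfSpace 2) M]
  [MeasurableSpace M] {u : M → E n} {x₀ : E n}

/-- The ratio `m(r)` as a real number, with the area of the exterior cone expressed through the
angular measure. It agrees with `extendedRatio` when the angular measure is finite. -/
def massRatio (u : M → E n) (x₀ : E n) (r : ℝ) : ℝ :=
  (areaMeasure u).real (u ⁻¹' Metric.ball x₀ r) / r ^ 2 +
    (∫ p : bdry M, max (1 - ‖u p - x₀‖ ^ 2 / r ^ 2) 0 ∂(angularMeasure u x₀)) / 2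

lemma integral_exteriorCone_nonneg (u : M → E n) (x₀ : E n) (r : ℝ) :
    0 ≤ ∫ p : bdry M, max (1 - ‖u p - x₀‖ ^ 2 / r ^ 2) 0 ∂(angularMeasure u x₀) :=
  integral_nonneg fun _ => le_max_right _ _

lemma massRatio_nonneg (u : M → E n) (x₀ : E n) (r : ℝ) : 0 ≤ massRatio u x₀ r :=
  add_nonneg (by positivity) (div_nonneg (integral_exteriorCone_nonneg u x₀ r) zero_le_two)

lemma integral_exteriorCone_le (u : M → E n) (x₀ : E n) [IsFiniteMeasure (angularMeasure u x₀)]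
    (r : ℝ) : ∫ p : bdry M, max (1 - ‖u p - x₀‖ ^ 2 / r ^ 2) 0 ∂(angularMeasure u x₀) ≤
      (angularMeasure u x₀).real univ := by
  calc _ ≤ ∫ _ : bdry M, (1 : ℝ) ∂(angularMeasure u x₀) :=
        integral_mono_of_nonneg (Eventually.of_forall fun _ => le_max_right _ _)
          (integrable_const _) (Eventually.of_forall fun _ =>
            max_le (sub_le_self _ (by positivity)) zero_le_one)
    _ = _ := by rw [integral_const, smul_eq_mul, mul_one]

variable [CompactSpace M] [IsManifold (𝓡∂ 2) 1 M] [BorelSpace M]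

lemma integrable_exteriorCone [IsFiniteMeasure (angularMeasure u x₀)] (hu : Continuous u)
    (r : ℝ) : Integrable (fun p : bdry M => max (1 - ‖u p - x₀‖ ^ 2 / r ^ 2) 0)
      (angularMeasure u x₀) :=
  integrable_angularMeasure_of_continuous (φ := fun p => max (1 - ‖u p - x₀‖ ^ 2 / r ^ 2) 0)
    (by fun_prop)

lemma tendsto_integral_exteriorCone [IsFiniteMeasure (angularMeasure u x₀)]
    (hu : ContMDiff (𝓡∂ 2) 𝓘(ℝ, E n) 1 u) :
    Tendsto (fun r => ∫ p : bdry M, max (1 - ‖u p - x₀‖ ^ 2 / r ^ 2) 0 ∂(angularMeasure u x₀))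
      (𝓝[>] 0) (𝓝 0) := by
  have hmeas (r : ℝ) := (integrable_exteriorCone (x₀ := x₀) hu.continuous r).aestronglyMeasurable
  suffices h : Tendsto _ _ (𝓝 (∫ _ : bdry M, (0 : ℝ) ∂(angularMeasure u x₀))) by
    rwa [integral_zero] at h
  refine tendsto_integral_filter_of_dominated_convergence (fun _ => 1)
    (Eventually.of_forall hmeas) (Eventually.of_forall fun r => Eventually.of_forall fun p => ?_)
    (integrable_const 1) ?_
  · rw [Real.norm_of_nonneg (le_max_right _ _)]
    exact max_le (sub_le_self _ (by positivity)) zero_le_one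
  · filter_upwards [ae_angularMeasure_ne hu x₀] with p hp
    refine tendsto_const_nhds.congr' ?_
    filter_upwards [Ioo_mem_nhdsGT (norm_pos_iff.2 (sub_ne_zero.2 hp))] with r hr
    refine (max_eq_right (sub_nonpos.2 ?_)).symm
    rw [one_le_div (by have := hr.1; positivity)]
    exact pow_le_pow_left₀ hr.1.le hr.2.le 2

lemma extendedRatio_eq_ofReal_massRatio [IsFiniteMeasure (angularMeasure u x₀)]
    (hu : ContMDiff (𝓡∂ 2) 𝓘(ℝ, E n) 1 u) {r : ℝ} (hr : 0 < r) :
    extendedRatio u x₀ r = ENNReal.ofReal (massRatio u x₀ r) := by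
  have := isFiniteMeasure_areaMeasure hu
  have := integral_exteriorCone_nonneg u x₀ r
  have hlintegral : ∫⁻ p : bdry M, ENNReal.ofReal (1 - ‖u p - x₀‖ ^ 2 / r ^ 2)
        ∂(angularMeasure u x₀) = ENNReal.ofReal
      (∫ p : bdry M, max (1 - ‖u p - x₀‖ ^ 2 / r ^ 2) 0 ∂(angularMeasure u x₀)) := by
    rw [ofReal_integral_eq_lintegral_ofReal (integrable_exteriorCone hu.continuous r)
      (Eventually.of_forall fun _ => le_max_right _ _)]
    simp only [ENNReal.ofReal_max, ENNReal.ofReal_zero, max_zero]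
  rw [extendedRatio, coneArea_Ici hu x₀ hr, surfaceArea, massRatio, hlintegral,
    ← ofReal_measureReal, ← ENNReal.ofReal_mul (by positivity),
    ← ENNReal.ofReal_add (by positivity) (by positivity),
    ← ENNReal.ofReal_div_of_pos (by positivity)]
  congr 1
  field_simp

end MassRatio

section Monotonicity

variable {n : ℕ} {M : Type*} [TopologicalSpace M] [ChartedSpace (EuclideanHalfSpace 2) M]
  [MeasurableSpace M] [BorelSpace M] {u : M → E n} {H : M → E n} {x₀ : E n} {α Λ σ r : ℝ}

lemma integral_radialWeight_mul_le (hu : Continuous u) (hH : Integrable H (areaMeasure u))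
    (hσ : 0 < σ) (hσr : σ < r) {β : ℝ} (hβ : ∀ p, ‖u p - x₀‖ < r → ‖u p - x₀‖ ≤ β) :
    ∫ p, radialWeight (σ ^ 2) (r ^ 2) (‖u p - x₀‖ ^ 2) * ‖u p - x₀‖ * ‖H p‖ ∂(areaMeasure u) ≤
      ((σ ^ 2)⁻¹ - (r ^ 2)⁻¹) * β *
        ∫ p in u ⁻¹' Metric.ball x₀ r, ‖H p‖ ∂(areaMeasure u) := by
  have hr : 0 < r := hσ.trans hσr
  have hsq : σ ^ 2 < r ^ 2 := by gcongr
  have hball : MeasurableSet (u ⁻¹' Metric.ball x₀ r) :=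
    (Metric.isOpen_ball.preimage hu).measurableSet
  rw [← integral_const_mul, ← integral_indicator hball]
  refine integral_mono_of_nonneg (Eventually.of_forall fun p =>
      mul_nonneg (mul_nonneg (radialWeight_nonneg _ _ _) (norm_nonneg _)) (norm_nonneg _))
    ((hH.norm.const_mul _).indicator hball) (Eventually.of_forall fun p => ?_)
  by_cases hp : ‖u p - x₀‖ < r
  · have hmem : p ∈ u ⁻¹' Metric.ball x₀ r := mem_ball_iff_norm.2 hp
    rw [indicator_of_mem hmem]
    have hle := radialWeight_le (pow_pos hσ 2) hsq (‖u p - x₀‖ ^ 2)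
    exact mul_le_mul_of_nonneg_right (mul_le_mul hle (hβ p hp) (norm_nonneg _)
      ((radialWeight_nonneg _ _ _).trans hle)) (norm_nonneg _)
  · have hmem : p ∉ u ⁻¹' Metric.ball x₀ r := mt mem_ball_iff_norm.1 hp
    have hzero := radialWeight_of_le (pow_pos hσ 2) hsq (pow_le_pow_left₀ hr.le (not_lt.1 hp) 2)
    simp only [indicator_of_notMem hmem, hzero, zero_mul, le_refl]

variable [CompactSpace M] [IsManifold (𝓡∂ 2) 1 M] [IsFiniteMeasure (angularMeasure u x₀)]

lemma integral_norm_le_massRatio (hu : ContMDiff (𝓡∂ 2) 𝓘(ℝ, E n) 1 u)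
    (hH : Integrable H (areaMeasure u)) (hα : 0 < α) (hΛ : 0 ≤ Λ) (hr : 0 < r)
    (hP : ∫⁻ p in u ⁻¹' Metric.ball x₀ r, ‖H p‖ₑ ∂(areaMeasure u) ≤
      ENNReal.ofReal (α * Λ * r ^ (α + 1)) * extendedRatio u x₀ r) :
    ∫ p in u ⁻¹' Metric.ball x₀ r, ‖H p‖ ∂(areaMeasure u) ≤
      α * Λ * r ^ (α + 1) * massRatio u x₀ r := by
  have hc : 0 ≤ α * Λ * r ^ (α + 1) := by positivity
  rw [extendedRatio_eq_ofReal_massRatio hu hr, ← ENNReal.ofReal_mul hc] at hP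
  rw [integral_norm_eq_lintegral_enorm hH.aestronglyMeasurable.restrict]
  exact ENNReal.toReal_le_of_le_ofReal (mul_nonneg hc (massRatio_nonneg u x₀ r)) hP

lemma massRatio_sub_massRatio_le (hu : ContMDiff (𝓡∂ 2) 𝓘(ℝ, E n) 1 u)
    (hH : Integrable H (areaMeasure u)) (hdiv : DivergenceIdentity u H) (hσ : 0 < σ)
    (hσr : σ < r) :
    massRatio u x₀ σ - massRatio u x₀ r ≤
      (∫ p, radialWeight (σ ^ 2) (r ^ 2) (‖u p - x₀‖ ^ 2) * ‖u p - x₀‖ * ‖H p‖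
        ∂(areaMeasure u)) / 2 := by
  have := isFiniteMeasure_areaMeasure hu
  have hr : 0 < r := hσ.trans hσr
  have hsq : σ ^ 2 < r ^ 2 := by gcongr
  have harea := area_div_sub_area_div_le (x₀ := x₀) hu hH hdiv (pow_pos hσ 2) hsq
  have hball_le : (areaMeasure u).real (u ⁻¹' Metric.ball x₀ σ) / σ ^ 2 ≤
      (areaMeasure u).real {p | ‖u p - x₀‖ ^ 2 ≤ σ ^ 2} / σ ^ 2 := by
    refine div_le_div_of_nonneg_right (measureReal_mono ?_) (sq_nonneg σ)
    exact fun p hp => pow_le_pow_left₀ (norm_nonneg _) (mem_ball_iff_norm.1 hp).le 2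
  have hball : u ⁻¹' Metric.ball x₀ r = {p | ‖u p - x₀‖ ^ 2 < r ^ 2} :=
    ext fun p => mem_ball_iff_norm.trans (sq_lt_sq₀ (norm_nonneg _) hr.le).symm
  have hcone : ∫ p : bdry M, ‖u p - x₀‖ ^ 2 * radialWeight (σ ^ 2) (r ^ 2) (‖u p - x₀‖ ^ 2)
        ∂(angularMeasure u x₀) =
      (∫ p : bdry M, max (1 - ‖u p - x₀‖ ^ 2 / r ^ 2) 0 ∂(angularMeasure u x₀)) -
        ∫ p : bdry M, max (1 - ‖u p - x₀‖ ^ 2 / σ ^ 2) 0 ∂(angularMeasure u x₀) := by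
    simp only [mul_radialWeight (pow_pos hσ 2) hsq]
    exact integral_sub (integrable_exteriorCone hu.continuous r)
      (integrable_exteriorCone hu.continuous σ)
  rw [massRatio, massRatio, hball]
  linarith

lemma monotoneOn_exp_mul_massRatio (hu : ContMDiff (𝓡∂ 2) 𝓘(ℝ, E n) 1 u)
    (hH : Integrable H (areaMeasure u)) (hdiv : DivergenceIdentity u H) (hα : 0 < α) (hΛ : 0 ≤ Λ)
    (hP : ∀ r, 0 < r → ∫ p in u ⁻¹' Metric.ball x₀ r, ‖H p‖ ∂(areaMeasure u) ≤
      α * Λ * r ^ (α + 1) * massRatio u x₀ r) :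
    MonotoneOn (fun r => Real.exp (Λ * r ^ α) * massRatio u x₀ r) (Ioi 0) := by
  refine monotoneOn_exp_mul_of_step hα hΛ (fun r _ => massRatio_nonneg u x₀ r) fun σ r hσ hσr => ?_
  have hr : 0 < r := hσ.trans hσr
  have hweight : 0 ≤ (σ ^ 2)⁻¹ - (r ^ 2)⁻¹ :=
    sub_nonneg.2 (inv_anti₀ (by positivity) (by gcongr))
  have hcurvature := (integral_radialWeight_mul_le hu.continuous hH hσ hσr fun p => le_of_lt).trans
    (mul_le_mul_of_nonneg_left (hP r hr) (mul_nonneg hweight hr.le))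
  have hstep := massRatio_sub_massRatio_le (x₀ := x₀) hu hH hdiv hσ hσr
  calc massRatio u x₀ σ
      ≤ massRatio u x₀ r +
          ((σ ^ 2)⁻¹ - (r ^ 2)⁻¹) * r * (α * Λ * r ^ (α + 1) * massRatio u x₀ r) / 2 := by
        linarith
    _ = (1 + α * Λ * r ^ α * ((r / σ) ^ 2 - 1) / 2) * massRatio u x₀ r := by
        rw [Real.rpow_add_one hr.ne']
        field_simp

lemma massRatio_mul_le_of_forall_norm_lt (hu : ContMDiff (𝓡∂ 2) 𝓘(ℝ, E n) 1 u)
    (hH : Integrable H (areaMeasure u)) (hdiv : DivergenceIdentity u H) (hσ : 0 < σ)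
    (hin : ∀ p, ‖u p - x₀‖ < σ)
    (hP : ∫ p in u ⁻¹' Metric.ball x₀ σ, ‖H p‖ ∂(areaMeasure u) ≤
      α * Λ * σ ^ (α + 1) * massRatio u x₀ σ) :
    massRatio u x₀ σ * (1 - α * Λ * σ ^ α / 2) ≤ (angularMeasure u x₀).real univ / 2 := by
  have huniv : ∀ r, σ ≤ r → u ⁻¹' Metric.ball x₀ r = univ := fun r hr =>
    eq_univ_of_forall fun p => mem_ball_iff_norm.2 ((hin p).trans_le hr)
  rw [huniv σ le_rfl, setIntegral_univ] at hP
  have : 0 ≤ ∫ p, ‖H p‖ ∂(areaMeasure u) := integral_nonneg fun p => norm_nonneg _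
  have hbound : ∀ᶠ r in atTop, massRatio u x₀ σ * (1 - α * Λ * σ ^ α / 2) ≤
      (areaMeasure u).real univ / r ^ 2 + (angularMeasure u x₀).real univ / 2 := by
    filter_upwards [eventually_gt_atTop σ] with r hr
    have hstep := massRatio_sub_massRatio_le (x₀ := x₀) hu hH hdiv hσ hr
    have hcurvature : ∫ p, radialWeight (σ ^ 2) (r ^ 2) (‖u p - x₀‖ ^ 2) * ‖u p - x₀‖ * ‖H p‖
        ∂(areaMeasure u) ≤ ((σ ^ 2)⁻¹ - (r ^ 2)⁻¹) * σ * ∫ p, ‖H p‖ ∂(areaMeasure u) := by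
      simpa only [huniv r hr.le, setIntegral_univ] using
        integral_radialWeight_mul_le hu.continuous hH hσ hr fun p _ => (hin p).le
    have hweight : ((σ ^ 2)⁻¹ - (r ^ 2)⁻¹) * σ * ∫ p, ‖H p‖ ∂(areaMeasure u) ≤
        massRatio u x₀ σ * (α * Λ * σ ^ α) := by
      calc _ ≤ (σ ^ 2)⁻¹ * σ * (α * Λ * σ ^ (α + 1) * massRatio u x₀ σ) := by
            gcongr
            exact sub_le_self _ (by positivity)
        _ = _ := by
            rw [Real.rpow_add_one hσ.ne']
            field_simp
    have hfar : massRatio u x₀ r ≤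
        (areaMeasure u).real univ / r ^ 2 + (angularMeasure u x₀).real univ / 2 := by
      rw [massRatio, huniv r hr.le]
      gcongr
      exact integral_exteriorCone_le u x₀ r
    linarith
  have hlim := ((tendsto_const_nhds (x := (areaMeasure u).real univ)).div_atTop
    (tendsto_pow_atTop two_ne_zero)).add_const ((angularMeasure u x₀).real univ / 2)
  rw [zero_add] at hlim
  exact ge_of_tendsto hlim hbound

lemma exists_tendsto_area_div_sq (hu : ContMDiff (𝓡∂ 2) 𝓘(ℝ, E n) 1 u) (hα : 0 < α)
    (hmono : MonotoneOn (fun r => Real.exp (Λ * r ^ α) * massRatio u x₀ r) (Ioi 0)) :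
    ∃ L : ℝ, 0 ≤ L ∧
      Tendsto (fun r => (areaMeasure u).real (u ⁻¹' Metric.ball x₀ r) / r ^ 2) (𝓝[>] 0) (𝓝 L) ∧
      ∀ r, 0 < r → L ≤ Real.exp (Λ * r ^ α) * massRatio u x₀ r := by
  have hnonneg : ∀ y ∈ (fun r => Real.exp (Λ * r ^ α) * massRatio u x₀ r) '' Ioi 0, 0 ≤ y :=
    forall_mem_image.2 fun r _ => mul_nonneg (Real.exp_pos _).le (massRatio_nonneg u x₀ r)
  have hbdd : BddBelow ((fun r => Real.exp (Λ * r ^ α) * massRatio u x₀ r) '' Ioi 0) :=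
    ⟨0, hnonneg⟩
  refine ⟨_, Real.sInf_nonneg hnonneg, ?_, fun r hr => csInf_le hbdd (mem_image_of_mem _ hr)⟩
  have hexp : Tendsto (fun r : ℝ => Real.exp (-(Λ * r ^ α))) (𝓝[>] 0) (𝓝 1) := by
    have hc : Continuous fun r : ℝ => Real.exp (-(Λ * r ^ α)) := by
      have := Real.continuous_rpow_const hα.le
      fun_prop
    simpa only [Real.zero_rpow hα.ne', mul_zero, neg_zero, Real.exp_zero] using
      (hc.tendsto 0).mono_left (nhdsWithin_le_nhds (s := Ioi 0))
  have hlim := (hexp.mul (hmono.tendsto_nhdsGT hbdd)).sub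
    ((tendsto_integral_exteriorCone (x₀ := x₀) hu).div_const 2)
  rw [one_mul, zero_div, sub_zero] at hlim
  refine hlim.congr fun r => ?_
  rw [← mul_assoc, ← Real.exp_add, neg_add_cancel, Real.exp_zero, one_mul, massRatio,
    add_sub_cancel_right]

end Monotonicity

section Density

lemma norm_sub_le_extrinsicDiam {n : ℕ} {M : Type*} [TopologicalSpace M] [CompactSpace M]
    {u : M → E n} {x₀ : E n} (hu : Continuous u) (hx : x₀ ∈ range u) (p : M) :
    ‖u p - x₀‖ ≤ extrinsicDiam u := by
  rw [← dist_eq_norm]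
  exact Metric.dist_le_diam_of_mem (isCompact_range hu).isBounded (mem_range_self p) hx

variable {n : ℕ} {M : Type*} [TopologicalSpace M] [ChartedSpace (EuclideanHalfSpace 2) M]
  [MeasurableSpace M] {u : M → E n} {x₀ : E n} {α Λ L : ℝ}

lemma exp_neg_mul_mul_le_of_le_massRatio {σ K : ℝ} (hK : 0 ≤ K) (hL : 0 ≤ L)
    (hLσ : L ≤ Real.exp (Λ * σ ^ α) * massRatio u x₀ σ)
    (hσK : massRatio u x₀ σ * (1 - α * Λ * σ ^ α / 2) ≤ K) :
    Real.exp (-(Λ * σ ^ α)) * (1 - α * Λ * σ ^ α / 2) * L ≤ K := by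
  rcases le_total (1 - α * Λ * σ ^ α / 2) 0 with hneg | hpos
  · exact (mul_nonpos_of_nonpos_of_nonneg
      (mul_nonpos_of_nonneg_of_nonpos (Real.exp_pos _).le hneg) hL).trans hK
  · calc Real.exp (-(Λ * σ ^ α)) * (1 - α * Λ * σ ^ α / 2) * L
        ≤ Real.exp (-(Λ * σ ^ α)) * (1 - α * Λ * σ ^ α / 2) *
          (Real.exp (Λ * σ ^ α) * massRatio u x₀ σ) := by gcongr
      _ = massRatio u x₀ σ * (1 - α * Λ * σ ^ α / 2) := by
          rw [Real.exp_neg]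
          field_simp
      _ ≤ K := hσK

variable [CompactSpace M]

lemma tendsto_area_div_sq_of_notMem_range (hu : Continuous u) (hx : x₀ ∉ range u) :
    Tendsto (fun r => (areaMeasure u).real (u ⁻¹' Metric.ball x₀ r) / r ^ 2) (𝓝[>] 0) (𝓝 0) := by
  obtain ⟨ε, hε, hball⟩ := Metric.isOpen_iff.1 (isCompact_range hu).isClosed.isOpen_compl x₀ hx
  refine tendsto_const_nhds.congr' ?_
  filter_upwards [Ioo_mem_nhdsGT hε] with r hr
  have hempty : u ⁻¹' Metric.ball x₀ r = ∅ := eq_empty_of_forall_notMem fun p hp =>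
    hball (Metric.ball_subset_ball hr.2.le hp) (mem_range_self p)
  rw [hempty, measureReal_empty, zero_div]

variable [IsManifold (𝓡∂ 2) 1 M] [BorelSpace M]

lemma hasDensity_surfaceArea (hu : ContMDiff (𝓡∂ 2) 𝓘(ℝ, E n) 1 u)
    (hL : Tendsto (fun r => (areaMeasure u).real (u ⁻¹' Metric.ball x₀ r) / r ^ 2) (𝓝[>] 0)
      (𝓝 L)) :
    HasDensity (surfaceArea u x₀) (ENNReal.ofReal (L / Real.pi)) := by
  have := isFiniteMeasure_areaMeasure hu
  refine (ENNReal.tendsto_ofReal (hL.div_const Real.pi)).congr' ?_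
  filter_upwards [self_mem_nhdsWithin] with r (hr : 0 < r)
  have := Real.pi_pos
  rw [surfaceArea, ← ofReal_measureReal, ← ENNReal.ofReal_div_of_pos (by positivity), div_div,
    mul_comm Real.pi]

lemma exp_neg_mul_mul_le_angularMeasure [IsFiniteMeasure (angularMeasure u x₀)] {H : M → E n}
    (hu : ContMDiff (𝓡∂ 2) 𝓘(ℝ, E n) 1 u) (hH : Integrable H (areaMeasure u))
    (hdiv : DivergenceIdentity u H) (hα : 0 < α)
    (hP : ∀ r, 0 < r → ∫ p in u ⁻¹' Metric.ball x₀ r, ‖H p‖ ∂(areaMeasure u) ≤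
      α * Λ * r ^ (α + 1) * massRatio u x₀ r) (hL0 : 0 ≤ L)
    (hL : Tendsto (fun r => (areaMeasure u).real (u ⁻¹' Metric.ball x₀ r) / r ^ 2) (𝓝[>] 0) (𝓝 L))
    (hLle : ∀ r, 0 < r → L ≤ Real.exp (Λ * r ^ α) * massRatio u x₀ r) :
    Real.exp (-(Λ * extrinsicDiam u ^ α)) * (1 - α * Λ * extrinsicDiam u ^ α / 2) * L ≤
      (angularMeasure u x₀).real univ / 2 := by
  have hK : 0 ≤ (angularMeasure u x₀).real univ / 2 := by positivity
  by_cases hx : x₀ ∈ range u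
  · have hcont : Continuous fun σ : ℝ =>
        Real.exp (-(Λ * σ ^ α)) * (1 - α * Λ * σ ^ α / 2) * L := by
      have := Real.continuous_rpow_const hα.le
      fun_prop
    refine le_of_tendsto ((hcont.tendsto (extrinsicDiam u)).mono_left nhdsWithin_le_nhds)
      (eventually_nhdsWithin_of_forall (s := Ioi (extrinsicDiam u)) fun σ hσ => ?_)
    have hσ0 : 0 < σ := Metric.diam_nonneg.trans_lt hσ
    exact exp_neg_mul_mul_le_of_le_massRatio hK hL0 (hLle σ hσ0)
      (massRatio_mul_le_of_forall_norm_lt hu hH hdiv hσ0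
        (fun p => (norm_sub_le_extrinsicDiam hu.continuous hx p).trans_lt hσ) (hP σ hσ0))
  · rwa [tendsto_nhds_unique hL (tendsto_area_div_sq_of_notMem_range hu.continuous hx), mul_zero]

end Density

end BranchedSurface

end

open BranchedSurface in
theorem theorem3p1_general {n : ℕ} {M : Type*} [TopologicalSpace M] [CompactSpace M]
    [ChartedSpace (EuclideanHalfSpace 2) M] [IsManifold (𝓡∂ 2) 1 M]
    [MeasurableSpace M] [BorelSpace M]
    (u : M → E n) (hu : ContMDiff (𝓡∂ 2) 𝓘(ℝ, E n) 1 u) (_hΓ : InjOn u (bdry M))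
    (H : M → E n) (hH : Integrable H (areaMeasure u)) (hdiv : DivergenceIdentity u H)
    (x₀ : E n) (α Λ : ℝ) (hα : 0 < α) (hΛ : 0 ≤ Λ)
    (hP : ∀ r : ℝ, 0 < r → ∫⁻ p in u ⁻¹' Metric.ball x₀ r, ‖H p‖ₑ ∂(areaMeasure u) ≤
      ENNReal.ofReal (α * Λ * r ^ (α + 1)) * extendedRatio u x₀ r) :
    ∃ θC : ℝ≥0∞, HasDensity (coneArea u x₀ (Icc 0 1)) θC ∧
      ENNReal.ofReal (Real.exp (-(Λ * extrinsicDiam u ^ α)) *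
          (1 - α * Λ * extrinsicDiam u ^ α / 2)) * upperDensity (surfaceArea u x₀) ≤ θC ∧
      (θC ≠ ⊤ → ∃ θM : ℝ≥0∞, θM ≠ ⊤ ∧ HasDensity (surfaceArea u x₀) θM) := by
  refine ⟨_, hasDensity_coneArea_Icc hu x₀, ?_⟩
  have := Real.pi_pos
  by_cases hfin : angularMeasure u x₀ univ = ⊤
  · rw [hfin, ENNReal.mul_top (by positivity)]
    exact ⟨le_top, fun h => absurd rfl h⟩
  have : IsFiniteMeasure (angularMeasure u x₀) := ⟨Ne.lt_top hfin⟩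
  have hreal (r : ℝ) (hr : 0 < r) := integral_norm_le_massRatio hu hH hα hΛ hr (hP r hr)
  obtain ⟨L, hL0, hL, hLle⟩ :=
    exists_tendsto_area_div_sq hu hα (monotoneOn_exp_mul_massRatio hu hH hdiv hα hΛ hreal)
  have hdensity : HasDensity (surfaceArea u x₀) (ENNReal.ofReal (L / Real.pi)) :=
    hasDensity_surfaceArea hu hL
  refine ⟨?_, fun _ => ⟨_, ENNReal.ofReal_ne_top, hdensity⟩⟩
  have hle := exp_neg_mul_mul_le_angularMeasure hu hH hdiv hα hreal hL0 hL hLle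
  rw [show upperDensity (surfaceArea u x₀) = _ from hdensity.limsup_eq, ← ofReal_measureReal,
    ← ENNReal.ofReal_mul' (by positivity), ← ENNReal.ofReal_mul (by positivity)]
  refine ENNReal.ofReal_le_ofReal ?_
  calc _ = Real.exp (-(Λ * extrinsicDiam u ^ α)) * (1 - α * Λ * extrinsicDiam u ^ α / 2) * L /
        Real.pi := (mul_div_assoc _ _ _).symm
    _ ≤ (angularMeasure u x₀).real univ / 2 / Real.pi := by gcongr
    _ = _ := by field_simp

open BranchedSurface in
theorem theorem3p1 {n : ℕ} {M : Type*} [TopologicalSpace M] [T2Space M] [CompactSpace M]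
    [ChartedSpace (EuclideanHalfSpace 2) M] [IsManifold (𝓡∂ 2) ∞ M]
    [MeasurableSpace M] [BorelSpace M]
    (u : M → E n) (hu : IsBranchedImmersion u) (hΓ : InjOn u (bdry M))
    (H : M → E n) (hH : HasMeanCurvature u H) (hdiv : DivergenceIdentity u H)
    (x₀ : E n) (α Λ : ℝ) (hP : PropertyP u H x₀ α Λ) :
    ∃ θC : ℝ≥0∞, HasDensity (coneArea u x₀ (Icc 0 1)) θC ∧
      ENNReal.ofReal (Real.exp (-(Λ * extrinsicDiam u ^ α)) *
          (1 - α * Λ * extrinsicDiam u ^ α / 2)) * upperDensity (surfaceArea u x₀) ≤ θC ∧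
      (θC ≠ ⊤ → ∃ θM : ℝ≥0∞, θM ≠ ⊤ ∧ HasDensity (surfaceArea u x₀) θM) :=
  theorem3p1_general u hu.1 hΓ H hH.1 hdiv x₀ α Λ hP.1 hP.2.2.1 hP.2.2.2
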